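/- Let $(M,\mathcal T)$ be a connected closed triangulated surface, i.e. $M$ is the connected quotient of a finite disjoint union of triangles obtained by identifying the sides of the triangles in pairs by homeomorphisms; let $V,E,F$ be its sets of vertices, edges and triangles. Let $\varepsilon:V\to\{0,1\}$ and $\eta:E\to\mathbb R$ satisfy $$\varepsilon_s\varepsilon_t+\eta_{st}>0\quad\text{for every edge } \{st\}\in E,\qquad \varepsilon_q\eta_{st}+\eta_{qs}\eta_{qt}\ge 0\quad\text{whenever } \{q,s,t\}=\{i,j,k\},\ \{ijk\}\in F.$$ For $f:V\to\mathbb R$ define edge lengths, in the Euclidean case, by $l_{ij}=\sqrt{\varepsilon_ie^{2f_i}+\varepsilon_je^{2f_j}+2\eta_{ij}e^{f_i+f_j}}$ and, in the hyperbolic case, by $l_{ij}=\cosh^{-1}\big(\sqrt{(1+\varepsilon_ie^{2f_i})(1+\varepsilon_je^{2f_j})}+\eta_{ij}e^{f_i+f_j}\big)$. Call $f$ a Euclidean (hyperbolic) discrete conformal structure if these lengths are positive and satisfy the strict triangle inequalities in every triangle. Its combinatorial curvature is $K_i=2\pi-\sum\theta_i$, the sum being over the corners of triangles at the vertex $i$,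 where $\theta_i$ is the inner angle at that corner of the Euclidean (hyperbolic) triangle with these edge lengths. For an arbitrary $f:V\to\mathbb R$ (a generalized discrete conformal structure) the extended curvature is $\widetilde K_i=2\pi-\sum\widetilde\theta_i$, where, at the corner $i$ of a triangle $ijk$, the extended angle $\widetilde\theta_i$ is $\theta_i$ if the lengths satisfy the strict triangle inequalities in $ijk$, is $\pi$ if they do not and $f\in V_i$, and is $0$ otherwise. Here $V_i$ is the set of those $f$ for which $$A_i>0\quad\text{and}\quad \kappa_i\ge\frac{-B_i+\sqrt{B_i^2-4A_iC_i}}{2A_i},$$ where $\kappa_i=e^{-f_i}$ in the Euclidean case and $\kappa_i=e^{-f_i}\sqrt{1+\varepsilon_ie^{2f_i}}$ in the hyperbolic case, $\gamma_i=\varepsilon_i\eta_{jk}+\eta_{ij}\eta_{ik}$ (and similarly $\gamma_j,\gamma_k$), $A_i=\eta_{jk}^2-\varepsilon_j\varepsilon_k$, $B_i=-2(\gamma_k\kappa_j+\gamma_j\kappa_k)$, and $C_i=(\eta_{ik}^2-\varepsilon_i\varepsilon_k)\kappa_j^2+(\eta_{ij}^2-\varepsilon_i\varepsilon_j)\kappa_k^2-2\gamma_i\kappa_j\kappa_k-G$,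 with $G=0$ in the Euclidean case and $G=\varepsilon_i\eta_{jk}^2+\varepsilon_j\eta_{ik}^2+\varepsilon_k\eta_{ij}^2+2\eta_{ij}\eta_{ik}\eta_{jk}-\varepsilon_i\varepsilon_j\varepsilon_k$ in the hyperbolic case. Then: (a) A Euclidean discrete conformal structure is determined by its combinatorial curvature exactly up to adding a constant vector: if $f$ is a Euclidean discrete conformal structure and $f':V\to\mathbb R$, then $f'$ is a Euclidean discrete conformal structure with the same curvature as $f$ if and only if $f'=f+c(1,\dots,1)$ for some $c\in\mathbb R$. (b) Two hyperbolic discrete conformal structures with the same combinatorial curvature are equal. (c) If $f_A$ is a Euclidean discrete conformal structure, $f_B:V\to\mathbb R$ is arbitrary, and $K(f_A)=\widetilde K(f_B)$, then there is a constant $c>0$ with $e^{f_A}=c\,e^{f_B}$. (d) If $f_A$ is a hyperbolic discrete conformal structure, $f_B:V\to\mathbb R$ is arbitrary, and $K(f_A)=\widetilde K(f_B)$, then $f_A=f_B$. -/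

import Mathlib

noncomputable section

/-- A closed triangulated surface: the quotient of a finite disjoint union of triangles, indexed by
`F`, by identifying all the sides of the triangles in pairs. The corners of a triangle `t` are the
pairs `(t, k)` with `k : Fin 3`; the pair `(t, k)` also denotes the side of `t` opposite to the
corner `(t, k)`, whose end points are the corners `(t, k + 1)` and `(t, k + 2)`. The side `s` is
glued to `mate s`, by the homeomorphism that preserves the cyclic labelling of the end points
(`k + 1 ↦ k' + 1`, `k + 2 ↦ k' + 2`) if `aligned s`, and by the one that exchanges it
(`k + 1 ↦ k' + 2`, `k + 2 ↦ k' + 1`) otherwise. No simpliciality is imposed: two sides of the same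
triangle may be glued, and several edges may have the same end points. -/
structure TriangulatedSurface (F : Type*) where
  mate : F × Fin 3 → F × Fin 3
  mate_mate : ∀ s, mate (mate s) = s
  mate_ne : ∀ s, mate s ≠ s
  aligned : F × Fin 3 → Bool
  aligned_mate : ∀ s, aligned (mate s) = aligned s

namespace TriangulatedSurface

variable {F : Type*} (T : TriangulatedSurface F)

/-- The identifications of corners induced by the gluing of the sides. -/
inductive CornerGlue : F × Fin 3 → F × Fin 3 → Prop
  | aligned_left (s : F × Fin 3) (h : T.aligned s = true) :
      CornerGlue (s.1, s.2 + 1) ((T.mate s).1, (T.mate s).2 + 1)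
  | aligned_right (s : F × Fin 3) (h : T.aligned s = true) :
      CornerGlue (s.1, s.2 + 2) ((T.mate s).1, (T.mate s).2 + 2)
  | crossed_left (s : F × Fin 3) (h : T.aligned s = false) :
      CornerGlue (s.1, s.2 + 1) ((T.mate s).1, (T.mate s).2 + 2)
  | crossed_right (s : F × Fin 3) (h : T.aligned s = false) :
      CornerGlue (s.1, s.2 + 2) ((T.mate s).1, (T.mate s).2 + 1)

/-- The set `V` of vertices: the classes of corners under the equivalence relation generated by
the gluing. -/
def Vertex : Type _ := Quot T.CornerGlue

/-- The set `E` of edges: the classes of sides under the gluing. -/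
def Edge : Type _ := Quot fun s s' : F × Fin 3 => T.mate s = s'

/-- The vertex at a corner. -/
def vertex (c : F × Fin 3) : T.Vertex := Quot.mk _ c

/-- The edge given by a side. -/
def edge (s : F × Fin 3) : T.Edge := Quot.mk _ s

/-- The surface is connected: it has a triangle, and any two triangles are joined by a chain of
triangles in which consecutive ones have sides glued to each other. -/
def Connected : Prop :=
  Nonempty F ∧ ∀ t t' : F,
    Relation.ReflTransGen (fun a b => ∃ i j : Fin 3, T.mate (a, i) = (b, j)) t t'

/-- The two end points of a side. -/
def endpoints (s : F × Fin 3) : Sym2 T.Vertex :=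
  s(T.vertex (s.1, s.2 + 1), T.vertex (s.1, s.2 + 2))

theorem endpoints_mate (s : F × Fin 3) : T.endpoints (T.mate s) = T.endpoints s := by
  unfold endpoints
  cases h : T.aligned s
  · have h1 : T.vertex (s.1, s.2 + 1) = T.vertex ((T.mate s).1, (T.mate s).2 + 2) :=
      Quot.sound (.crossed_left s h)
    have h2 : T.vertex (s.1, s.2 + 2) = T.vertex ((T.mate s).1, (T.mate s).2 + 1) :=
      Quot.sound (.crossed_right s h)
    rw [h1, h2, Sym2.eq_swap]
  · have h1 : T.vertex (s.1, s.2 + 1) = T.vertex ((T.mate s).1, (T.mate s).2 + 1) :=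
      Quot.sound (.aligned_left s h)
    have h2 : T.vertex (s.1, s.2 + 2) = T.vertex ((T.mate s).1, (T.mate s).2 + 2) :=
      Quot.sound (.aligned_right s h)
    rw [h1, h2]

/-- The function on edges with value `g i j e` on the edge `e` with end points `i` and `j`, for `g`
symmetric in `i` and `j`. -/
def edgeFun (g : T.Vertex → T.Vertex → T.Edge → ℝ) (hg : ∀ i j e, g i j e = g j i e) :
    T.Edge → ℝ :=
  Quot.lift
    (fun s => g (T.vertex (s.1, s.2 + 1)) (T.vertex (s.1, s.2 + 2)) (T.edge s)) (by
      rintro s _ rfl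
      have he : T.edge (T.mate s) = T.edge s := by
        refine (Quot.sound ?_ : T.edge s = T.edge (T.mate s)).symm
        rfl
      have hv := T.endpoints_mate s
      simp only [endpoints, Sym2.eq_iff] at hv
      simp only [he]
      rcases hv with ⟨h1, h2⟩ | ⟨h1, h2⟩
      · rw [h1, h2]
      · rw [h1, h2, hg])

section DiscreteConformalStructures

variable (ε : T.Vertex → ℝ) (η : T.Edge → ℝ)

/-- First structure condition: `ε_s ε_t + η_st > 0` for every edge `st`. -/
def StructureCondition1 : Prop :=
  ∀ s : F × Fin 3, 0 < ε (T.vertex (s.1, s.2 + 1)) * ε (T.vertex (s.1, s.2 + 2)) + η (T.edge s)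

/-- Second structure condition: `ε_q η_st + η_qs η_qt ≥ 0` for every triangle and every choice of
its corner `q`. -/
def StructureCondition2 : Prop :=
  ∀ (t : F) (q : Fin 3),
    0 ≤ ε (T.vertex (t, q)) * η (T.edge (t, q)) + η (T.edge (t, q + 1)) * η (T.edge (t, q + 2))

/-- A triangle is nondegenerate for the edge lengths `l`: the strict triangle
inequalities hold. -/
def Nondegenerate (l : T.Edge → ℝ) (t : F) : Prop :=
  ∀ k : Fin 3, l (T.edge (t, k)) < l (T.edge (t, k + 1)) + l (T.edge (t, k + 2))

/-- `l` is a (Euclidean or hyperbolic) polyhedral metric: it is positive, and in each triangle the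
strict triangle inequalities hold, so that the triangle is realized by a nondegenerate triangle
in the Euclidean (equivalently, in the hyperbolic) plane. -/
def IsPolyhedralMetric (l : T.Edge → ℝ) : Prop :=
  (∀ e, 0 < l e) ∧ ∀ t : F, T.Nondegenerate l t

/-- Combinatorial curvature of a system of angles at the corners: `2π` minus the sum of the angles
at the vertex. -/
def curvature [Fintype F] (θ : F × Fin 3 → ℝ) (v : T.Vertex) : ℝ :=
  open Classical in 2 * Real.pi - ∑ c : F × Fin 3 with T.vertex c = v, θ c

/-- Inner angle of a Euclidean polyhedral metric at a corner, by the cosine law. -/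
def euclideanAngle (l : T.Edge → ℝ) (c : F × Fin 3) : ℝ :=
  let a := l (T.edge (c.1, c.2))
  let b := l (T.edge (c.1, c.2 + 1))
  let d := l (T.edge (c.1, c.2 + 2))
  Real.arccos ((b ^ 2 + d ^ 2 - a ^ 2) / (2 * b * d))

/-- Inner angle of a hyperbolic polyhedral metric at a corner, by the hyperbolic cosine law. -/
def hyperbolicAngle (l : T.Edge → ℝ) (c : F × Fin 3) : ℝ :=
  let a := l (T.edge (c.1, c.2))
  let b := l (T.edge (c.1, c.2 + 1))
  let d := l (T.edge (c.1, c.2 + 2))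
  Real.arccos ((Real.cosh b * Real.cosh d - Real.cosh a) / (Real.sinh b * Real.sinh d))

/-- Euclidean edge length `l_ij = √(ε_i e^{2 f_i} + ε_j e^{2 f_j} + 2 η_ij e^{f_i + f_j})`. -/
def euclideanLength (f : T.Vertex → ℝ) : T.Edge → ℝ :=
  T.edgeFun
    (fun i j e => √(ε i * Real.exp (2 * f i) + ε j * Real.exp (2 * f j)
      + 2 * η e * Real.exp (f i + f j)))
    (fun i j e => by
      rw [add_comm (f i), add_comm (ε i * Real.exp (2 * f i))])

/-- Hyperbolic edge length
`l_ij = arcosh (√((1 + ε_i e^{2 f_i}) (1 + ε_j e^{2 f_j})) + η_ij e^{f_i + f_j})`. -/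
def hyperbolicLength (f : T.Vertex → ℝ) : T.Edge → ℝ :=
  T.edgeFun
    (fun i j e => Real.arcosh (√((1 + ε i * Real.exp (2 * f i)) * (1 + ε j * Real.exp (2 * f j)))
      + η e * Real.exp (f i + f j)))
    (fun i j e => by
      rw [add_comm (f i), mul_comm (1 + ε i * Real.exp (2 * f i))])

/-- `f` is a Euclidean discrete conformal structure. -/
def IsEuclideanDCS (f : T.Vertex → ℝ) : Prop :=
  T.IsPolyhedralMetric (T.euclideanLength ε η f)

/-- `f` is a hyperbolic discrete conformal structure. -/
def IsHyperbolicDCS (f : T.Vertex → ℝ) : Prop :=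
  T.IsPolyhedralMetric (T.hyperbolicLength ε η f)

/-- Combinatorial curvature of a Euclidean discrete conformal structure. -/
def euclideanCurvature [Fintype F] (f : T.Vertex → ℝ) : T.Vertex → ℝ :=
  T.curvature (T.euclideanAngle (T.euclideanLength ε η f))

/-- Combinatorial curvature of a hyperbolic discrete conformal structure. -/
def hyperbolicCurvature [Fintype F] (f : T.Vertex → ℝ) : T.Vertex → ℝ :=
  T.curvature (T.hyperbolicAngle (T.hyperbolicLength ε η f))

/-- `γ_i = ε_i η_jk + η_ij η_ik` at the corner `i` of a triangle `ijk`. -/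
def gam (c : F × Fin 3) : ℝ :=
  ε (T.vertex c) * η (T.edge c) + η (T.edge (c.1, c.2 + 1)) * η (T.edge (c.1, c.2 + 2))

/-- `A_i = η_jk² - ε_j ε_k` at the corner `i` of a triangle `ijk`. -/
def coeffA (c : F × Fin 3) : ℝ :=
  η (T.edge c) ^ 2 - ε (T.vertex (c.1, c.2 + 1)) * ε (T.vertex (c.1, c.2 + 2))

/-- `B_i = -2 (γ_k κ_j + γ_j κ_k)` at the corner `i` of a triangle `ijk`. -/
def coeffB (κ : T.Vertex → ℝ) (c : F × Fin 3) : ℝ :=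
  -2 * (T.gam ε η (c.1, c.2 + 2) * κ (T.vertex (c.1, c.2 + 1))
    + T.gam ε η (c.1, c.2 + 1) * κ (T.vertex (c.1, c.2 + 2)))

/-- `(η_ik² - ε_i ε_k) κ_j² + (η_ij² - ε_i ε_j) κ_k² - 2 γ_i κ_j κ_k` at the corner `i` of a
triangle `ijk`. -/
def coeffC (κ : T.Vertex → ℝ) (c : F × Fin 3) : ℝ :=
  T.coeffA ε η (c.1, c.2 + 1) * κ (T.vertex (c.1, c.2 + 1)) ^ 2
    + T.coeffA ε η (c.1, c.2 + 2) * κ (T.vertex (c.1, c.2 + 2)) ^ 2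
    - 2 * κ (T.vertex (c.1, c.2 + 1)) * κ (T.vertex (c.1, c.2 + 2)) * T.gam ε η c

/-- `G = ε_i η_jk² + ε_j η_ik² + ε_k η_ij² + 2 η_ij η_ik η_jk - ε_i ε_j ε_k` in a triangle. -/
def termG (t : F) : ℝ :=
  ∑ k : Fin 3, ε (T.vertex (t, k)) * η (T.edge (t, k)) ^ 2
    + 2 * ∏ k : Fin 3, η (T.edge (t, k)) - ∏ k : Fin 3, ε (T.vertex (t, k))

/-- The degenerate region `A_i > 0`, `κ_i ≥ (-B_i + √Δ_i) / (2 A_i)`, with discriminant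
`Δ_i = B_i² - 4 A_i C_i`. -/
def InRegion (A B C κ : ℝ) : Prop :=
  0 < A ∧ (-B + √(B ^ 2 - 4 * A * C)) / (2 * A) ≤ κ

/-- `f` lies in the degenerate region `V_i` of Euclidean generalized structures, at the corner `i`
of a triangle; here `κ = e^{-f}`. -/
def InEuclideanRegion (f : T.Vertex → ℝ) (c : F × Fin 3) : Prop :=
  let κ : T.Vertex → ℝ := fun v => (Real.exp (f v))⁻¹
  InRegion (T.coeffA ε η c) (T.coeffB ε η κ c) (T.coeffC ε η κ c) (κ (T.vertex c))

/-- `f` lies in the degenerate region `V_i` of hyperbolic generalized structures, at the corner `i`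
of a triangle; here `κ = √(1 + ε e^{2f}) / e^f`. -/
def InHyperbolicRegion (f : T.Vertex → ℝ) (c : F × Fin 3) : Prop :=
  let κ : T.Vertex → ℝ := fun v => √(1 + ε v * Real.exp (2 * f v)) / Real.exp (f v)
  InRegion (T.coeffA ε η c) (T.coeffB ε η κ c) (T.coeffC ε η κ c - T.termG ε η c.1)
    (κ (T.vertex c))

/-- Extended Euclidean inner angle: the inner angle if the triangle is nondegenerate, `π` if `f`
lies in the degenerate region of the corner, and `0` otherwise. -/
def euclideanExtAngle (f : T.Vertex → ℝ) (c : F × Fin 3) : ℝ :=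
  open Classical in
  if T.Nondegenerate (T.euclideanLength ε η f) c.1 then
    T.euclideanAngle (T.euclideanLength ε η f) c
  else if T.InEuclideanRegion ε η f c then Real.pi else 0

/-- Extended hyperbolic inner angle. -/
def hyperbolicExtAngle (f : T.Vertex → ℝ) (c : F × Fin 3) : ℝ :=
  open Classical in
  if T.Nondegenerate (T.hyperbolicLength ε η f) c.1 then
    T.hyperbolicAngle (T.hyperbolicLength ε η f) c
  else if T.InHyperbolicRegion ε η f c then Real.pi else 0

/-- Extended combinatorial curvature of a generalized Euclidean discrete conformal structure,
that is, of an arbitrary `f : V → ℝ`. -/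
def euclideanExtCurvature [Fintype F] (f : T.Vertex → ℝ) : T.Vertex → ℝ :=
  T.curvature (T.euclideanExtAngle ε η f)

/-- Extended combinatorial curvature of a generalized hyperbolic discrete conformal structure,
that is, of an arbitrary `f : V → ℝ`. -/
def hyperbolicExtCurvature [Fintype F] (f : T.Vertex → ℝ) : T.Vertex → ℝ :=
  T.curvature (T.hyperbolicExtAngle ε η f)

end DiscreteConformalStructures

end TriangulatedSurface

end

/-! Both geometries are treated at once, with `lam = 0` Euclidean and `lam = 1` hyperbolic. In the
coordinates `x = κ`, the squared sides, the cosines of the angles and the squared area become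
polynomials after normalization. Along a path with `x' = w * s`, where `s = e^{-f}` and `w` is
constant at each vertex (a straight line in the logarithmic coordinate `logCoord`), the derivative
of `∑ θ_i w_i` over one triangle is a quadratic form in `w` divided by the square root of the area
polynomial.

Infinitesimal rigidity (`formDefinite`): in a nondegenerate triangle this form is positive definite,
up to the constant vectors in the Euclidean case. The Jacobian of the angles factors as (angles by
sides) times (sides by vertices), so its determinant is a square times `cyclicSum`, which the
structure conditions make positive. At most one of the three signed distances `height` is negative
and at most one edge weight is negative, so the vertices can be ordered to make all leading minors
positive. Sylvester's criterion concludes.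

Degenerate triangles (`cosNum_neg_iff`): the cosine law still makes sense, its argument lies outside
`(-1, 1)`, and `Real.arccos` clamps it to `0` or `π`. The value is `π` exactly when the power center
lies on or beyond the opposite side, and this is the region `V_i`. Thus one continuous function
`cornerAngle` computes both the inner angle and the extended angle.

Global rigidity (`angleWork_monotone`, `logCoord_sub_eq`): join a nondegenerate structure to a
generalized one by such a path. In each triangle `∑ θ_i w_i` is continuous, takes finitely many
values while the triangle is degenerate, and otherwise has nonnegative derivative; hence it is
monotone, and it increases strictly at the start unless `w` lies in the kernel. Equal curvatures
make the total over all triangles equal at both ends, so `w` is in the kernel in every triangle. By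
connectedness it is constant, and zero in the hyperbolic case. -/

noncomputable section

/-! ### Polynomial identities in one triangle. -/

namespace DiscreteConformal

/-- Normalized squared length of the side with end points `1` and `2`. -/
def sideSq (lam e1 e2 n x1 x2 : ℝ) : ℝ :=
  e1 * x2 ^ 2 + e2 * x1 ^ 2 + 2 * n * x1 * x2 + lam * (n ^ 2 - e1 * e2)

/-- Numerator of the cosine of the angle at the corner `1`. -/
def cosNum (lam e1 n1 n2 n3 x1 x2 x3 : ℝ) : ℝ :=
  lam * (e1 * n1 + n2 * n3) + e1 * x2 * x3 + x1 * (x2 * n2 + x3 * n3) - x1 ^ 2 * n1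

/-- Normalized signed distance from the power center of the triangle to the side opposite to the
corner `1`. -/
def height (e2 e3 n1 n2 n3 x1 x2 x3 : ℝ) : ℝ :=
  -(n1 ^ 2 - e2 * e3) * x1 + (e3 * n3 + n1 * n2) * x2 + (e2 * n2 + n1 * n3) * x3

/-- Minus the determinant of the Gram matrix of the triangle. -/
def gramDet (e1 e2 e3 n1 n2 n3 : ℝ) : ℝ :=
  e1 * n1 ^ 2 + e2 * n2 ^ 2 + e3 * n3 ^ 2 + 2 * (n1 * n2 * n3) - e1 * e2 * e3

/-- Normalized squared area; the triangle is nondegenerate if and only if it is positive. -/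
def areaSq (lam e1 e2 e3 n1 n2 n3 x1 x2 x3 : ℝ) : ℝ :=
  x1 * height e2 e3 n1 n2 n3 x1 x2 x3 + x2 * height e3 e1 n2 n3 n1 x2 x3 x1
    + x3 * height e1 e2 n3 n1 n2 x3 x1 x2 + lam * gramDet e1 e2 e3 n1 n2 n3

/-- The sum of the two cyclic products of the partial derivatives of the side lengths. -/
def cyclicSum (e1 e2 e3 n1 n2 n3 x1 x2 x3 : ℝ) : ℝ :=
  (e1 * x2 + n3 * x1) * (e2 * x3 + n1 * x2) * (e3 * x1 + n2 * x3)
    + (e1 * x3 + n2 * x1) * (e3 * x2 + n1 * x3) * (e2 * x1 + n3 * x2)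

section Identities

variable (lam e1 e2 e3 n1 n2 n3 x1 x2 x3 : ℝ)

theorem sideSq_swap (n : ℝ) : sideSq lam e1 e2 n x1 x2 = sideSq lam e2 e1 n x2 x1 := by
  unfold sideSq; ring

theorem cosNum_swap : cosNum lam e1 n1 n2 n3 x1 x2 x3 = cosNum lam e1 n1 n3 n2 x1 x3 x2 := by
  unfold cosNum; ring

theorem height_swap : height e2 e3 n1 n2 n3 x1 x2 x3 = height e3 e2 n1 n3 n2 x1 x3 x2 := by
  unfold height; ring

theorem gramDet_rotate : gramDet e1 e2 e3 n1 n2 n3 = gramDet e2 e3 e1 n2 n3 n1 := by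
  unfold gramDet; ring

theorem areaSq_rotate :
    areaSq lam e1 e2 e3 n1 n2 n3 x1 x2 x3 = areaSq lam e2 e3 e1 n2 n3 n1 x2 x3 x1 := by
  unfold areaSq; rw [gramDet_rotate]; ring

theorem areaSq_swap :
    areaSq lam e1 e2 e3 n1 n2 n3 x1 x2 x3 = areaSq lam e1 e3 e2 n1 n3 n2 x1 x3 x2 := by
  unfold areaSq height gramDet; ring

/-- This is `sin² = 1 - cos²` cleared of denominators. For `lam = 1` the numbers `-sideSq` and
`cosNum` are the entries of the adjugate of the matrix with diagonal `x_i² - e_i` and off-diagonal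
entries `x_i x_j + n_k`, whose determinant is `areaSq`; this identity and the next two are relations
between that matrix and its adjugate, and they persist for `lam = 0`. -/
theorem sideSq_mul_sideSq_sub_cosNum_sq :
    sideSq lam e3 e1 n2 x3 x1 * sideSq lam e1 e2 n3 x1 x2
        - cosNum lam e1 n1 n2 n3 x1 x2 x3 ^ 2
      = (x1 ^ 2 - lam * e1) * areaSq lam e1 e2 e3 n1 n2 n3 x1 x2 x3 := by
  unfold sideSq cosNum areaSq height gramDet; ring

/-- The second cosine law, expressing a side by the three angles. -/
theorem cosNum_mul_cosNum_add :
    cosNum lam e1 n1 n2 n3 x1 x2 x3 * cosNum lam e2 n2 n3 n1 x2 x3 x1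
        + sideSq lam e1 e2 n3 x1 x2 * cosNum lam e3 n3 n1 n2 x3 x1 x2
      = areaSq lam e1 e2 e3 n1 n2 n3 x1 x2 x3 * (x1 * x2 + lam * n3) := by
  unfold sideSq cosNum areaSq height gramDet; ring

/-- The projection formula; it excludes two angles that are both right or obtuse. -/
theorem cosNum_add_cosNum :
    (x1 ^ 2 - lam * e1) * cosNum lam e3 n3 n1 n2 x3 x1 x2
        + (x3 * x1 + lam * n2) * cosNum lam e1 n1 n2 n3 x1 x2 x3
      = (x1 * x2 + lam * n3) * sideSq lam e3 e1 n2 x3 x1 := by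
  unfold sideSq cosNum; ring

/-- The chain rule through the side lengths collapses to a single height: this gives the
off-diagonal entries of the Jacobian of the angles, and the next identity gives the diagonal ones.
-/
theorem sideSq_mul_sub_cosNum_mul :
    sideSq lam e1 e2 n3 x1 x2 * (e1 * x3 + n2 * x1)
        - cosNum lam e1 n1 n2 n3 x1 x2 x3 * (e1 * x2 + n3 * x1)
      = (x1 ^ 2 - lam * e1) * height e1 e2 n3 n1 n2 x3 x1 x2 := by
  unfold sideSq cosNum height; ring

theorem height_mul_sub_cosNum_mul :
    height e1 e2 n3 n1 n2 x3 x1 x2 * (x1 * x2 + lam * n3)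
        - cosNum lam e2 n2 n3 n1 x2 x3 x1 * (e1 * x2 + n3 * x1)
      = sideSq lam e1 e2 n3 x1 x2 * (n2 * x2 - n3 * x3) := by
  unfold sideSq cosNum height; ring

/-- Relates the signs of two heights, so that both cannot be negative. -/
theorem coeff_mul_height :
    (n1 ^ 2 - e2 * e3) * height e3 e1 n2 n3 n1 x2 x3 x1
      = gramDet e1 e2 e3 n1 n2 n3 * (e3 * x2 + n1 * x3)
        - (e3 * n3 + n1 * n2) * height e2 e3 n1 n2 n3 x1 x2 x3 := by
  unfold gramDet height; ring

theorem gramDet_mul :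
    gramDet e1 e2 e3 n1 n2 n3 * n1
      = (e2 * n2 + n1 * n3) * (e3 * n3 + n1 * n2) + (n1 ^ 2 - e2 * e3) * (e1 * n1 + n2 * n3) := by
  unfold gramDet; ring

theorem mixed_sq_sub :
    (x1 * x2 + lam * n3) ^ 2 - (x1 ^ 2 - lam * e1) * (x2 ^ 2 - lam * e2)
      = lam * sideSq lam e1 e2 n3 x1 x2 := by
  unfold sideSq; ring

theorem cyclicSum_eq :
    cyclicSum e1 e2 e3 n1 n2 n3 x1 x2 x3 = 2 * (n1 * n2 * n3 + e1 * e2 * e3) * (x1 * x2 * x3)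
      + (e1 * n1 + n2 * n3) * x1 * (e2 * x3 ^ 2 + e3 * x2 ^ 2)
      + (e2 * n2 + n3 * n1) * x2 * (e3 * x1 ^ 2 + e1 * x3 ^ 2)
      + (e3 * n3 + n1 * n2) * x3 * (e1 * x2 ^ 2 + e2 * x1 ^ 2) := by
  unfold cyclicSum; ring

theorem height_eq_mixed :
    (x2 * x3 + lam * n1) * (e1 * x2 + n3 * x1) + (x3 * x1 + lam * n2) * (e2 * x1 + n3 * x2)
        - x3 * sideSq lam e1 e2 n3 x1 x2
      = lam * height e1 e2 n3 n1 n2 x3 x1 x2 := by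
  unfold sideSq height; ring

theorem sideSq_eq_mixed :
    x3 * sideSq lam e3 e1 n2 x3 x1
      = (x3 * x1 + lam * n2) * (e3 * x1 + n2 * x3) + (x3 ^ 2 - lam * e3) * (e1 * x3 + n2 * x1) := by
  unfold sideSq; ring

end Identities

end DiscreteConformal

/-! ### Sign consequences of the structure conditions, and criteria for definiteness. -/

namespace DiscreteConformal

/-- The structure conditions in a triangle with vertex weights `e` and edge weights `n`, the edge
`k` being opposite to the vertex `k`. -/
structure Admissible (e1 e2 e3 n1 n2 n3 : ℝ) : Prop where
  weight1 : e1 = 0 ∨ e1 = 1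
  weight2 : e2 = 0 ∨ e2 = 1
  weight3 : e3 = 0 ∨ e3 = 1
  edge1 : 0 < e2 * e3 + n1
  edge2 : 0 < e3 * e1 + n2
  edge3 : 0 < e1 * e2 + n3
  corner1 : 0 ≤ e1 * n1 + n2 * n3
  corner2 : 0 ≤ e2 * n2 + n3 * n1
  corner3 : 0 ≤ e3 * n3 + n1 * n2

variable {lam e1 e2 e3 n1 n2 n3 x1 x2 x3 : ℝ}

theorem Admissible.rotate (h : Admissible e1 e2 e3 n1 n2 n3) : Admissible e2 e3 e1 n2 n3 n1 :=
  ⟨h.weight2, h.weight3, h.weight1, h.edge2, h.edge3, h.edge1, h.corner2, h.corner3, h.corner1⟩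

theorem Admissible.swap (h : Admissible e1 e2 e3 n1 n2 n3) : Admissible e1 e3 e2 n1 n3 n2 := by
  obtain ⟨a, b, c, d, e, f, g, i, j⟩ := h
  exact ⟨a, c, b, by linarith, by linarith, by linarith, by linarith, by linarith, by linarith⟩

/-- The range of the coordinates `x` at a vertex of weight `e`. -/
structure InRange (lam e x : ℝ) : Prop where
  pos : 0 < x
  sq_sub_pos : 0 < x ^ 2 - lam * e

theorem one_lt_of_inRange (h : InRange 1 1 x1) : 1 < x1 := by
  have := h.pos
  have := h.sq_sub_pos
  nlinarith

theorem sideSq_pos (hl : lam = 0 ∨ lam = 1) (h1 : e1 = 0 ∨ e1 = 1) (h2 : e2 = 0 ∨ e2 = 1)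
    (hn : 0 < e1 * e2 + n1) (hx1 : InRange lam e1 x1) (hx2 : InRange lam e2 x2) :
    0 < sideSq lam e1 e2 n1 x1 x2 := by
  have p1 := hx1.pos
  have p2 := hx2.pos
  have p12 := mul_pos p1 p2
  unfold sideSq
  rcases h1 with rfl | rfl <;> rcases h2 with rfl | rfl
  · rcases hl with rfl | rfl <;> · simp only [zero_mul, zero_add] at hn; simp; positivity
  · rcases hl with rfl | rfl <;> · simp only [zero_mul, zero_add] at hn; simp; positivity
  · rcases hl with rfl | rfl <;> · simp only [mul_zero, zero_add] at hn; simp; positivity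
  · rcases hl with rfl | rfl
    · nlinarith [sq_nonneg (x1 - x2), mul_pos hn p12]
    · have a1 := one_lt_of_inRange hx1
      have a2 := one_lt_of_inRange hx2
      have : 1 < x1 * x2 := by nlinarith
      have := mul_pos hn (show 0 < 2 * (x1 * x2) + n1 - 1 by linarith)
      nlinarith [sq_nonneg (x1 - x2)]

theorem mixed_pos (hl : lam = 0 ∨ lam = 1) (h1 : e1 = 0 ∨ e1 = 1) (h2 : e2 = 0 ∨ e2 = 1)
    (hn : 0 < e1 * e2 + n1) (hx1 : InRange lam e1 x1) (hx2 : InRange lam e2 x2) :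
    0 < x1 * x2 + lam * n1 := by
  have p1 := hx1.pos
  have p2 := hx2.pos
  have p12 := mul_pos p1 p2
  rcases hl with rfl | rfl
  · simpa using p12
  rcases h1 with rfl | rfl
  · linarith
  rcases h2 with rfl | rfl
  · linarith
  have a1 := one_lt_of_inRange hx1
  have a2 := one_lt_of_inRange hx2
  nlinarith

theorem two_mul_le_of_weights (h1 : e1 = 0 ∨ e1 = 1) (h2 : e2 = 0 ∨ e2 = 1) :
    2 * (e1 * e2) * (x1 * x2) ≤ e1 * x2 ^ 2 + e2 * x1 ^ 2 := by
  rcases h1 with rfl | rfl <;> rcases h2 with rfl | rfl <;>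
    nlinarith [sq_nonneg (x1 - x2), sq_nonneg x1, sq_nonneg x2]

/-- The corner conditions allow each `e2 * x3 ^ 2 + e3 * x2 ^ 2` to be replaced by its lower bound
`2 * (e2 * e3) * (x2 * x3)`. Since the weights are idempotent, the resulting sum is `2 * x1 * x2 *
x3` times the product of the three positive quantities of the edge conditions. -/
theorem cyclicSum_pos (h : Admissible e1 e2 e3 n1 n2 n3) (hx1 : 0 < x1) (hx2 : 0 < x2)
    (hx3 : 0 < x3) : 0 < cyclicSum e1 e2 e3 n1 n2 n3 x1 x2 x3 := by
  rw [cyclicSum_eq]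
  have q1 := mul_le_mul_of_nonneg_left
    (two_mul_le_of_weights (x1 := x2) (x2 := x3) h.weight2 h.weight3)
    (mul_nonneg h.corner1 hx1.le)
  have q2 := mul_le_mul_of_nonneg_left
    (two_mul_le_of_weights (x1 := x3) (x2 := x1) h.weight3 h.weight1)
    (mul_nonneg h.corner2 hx2.le)
  have q3 := mul_le_mul_of_nonneg_left
    (two_mul_le_of_weights (x1 := x1) (x2 := x2) h.weight1 h.weight2)
    (mul_nonneg h.corner3 hx3.le)
  have key : 0 < (e2 * e3 + n1) * (e3 * e1 + n2) * (e1 * e2 + n3) * (x1 * x2 * x3) :=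
    mul_pos (mul_pos (mul_pos h.edge1 h.edge2) h.edge3) (mul_pos (mul_pos hx1 hx2) hx3)
  have s1 : e1 * e1 = e1 := by rcases h.weight1 with r | r <;> rw [r] <;> ring
  have s2 : e2 * e2 = e2 := by rcases h.weight2 with r | r <;> rw [r] <;> ring
  have s3 : e3 * e3 = e3 := by rcases h.weight3 with r | r <;> rw [r] <;> ring
  have eq : (e2 * e3 + n1) * (e3 * e1 + n2) * (e1 * e2 + n3)
      = n1 * n2 * n3 + e1 * e2 * e3 + (e1 * n1 + n2 * n3) * (e2 * e3)
        + (e2 * n2 + n3 * n1) * (e3 * e1) + (e3 * n3 + n1 * n2) * (e1 * e2) := by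
    rcases h.weight1 with r | r <;> rcases h.weight2 with r' | r' <;>
      rcases h.weight3 with r'' | r'' <;> rw [r, r', r''] <;> ring
  rw [eq] at key
  linarith

/-- At most one edge weight is negative. -/
theorem Admissible.nonneg_or_nonneg (h : Admissible e1 e2 e3 n1 n2 n3) : 0 ≤ n2 ∨ 0 ≤ n3 := by
  by_contra! hc
  obtain ⟨h2, h3⟩ := hc
  obtain ⟨w1, w2, w3, d1, d2, d3, c1, c2, c3⟩ := h
  have r1 : e1 = 1 := by rcases w1 with r | r <;> [(subst r; linarith); exact r]
  have r2 : e2 = 1 := by rcases w2 with r | r <;> [(subst r; linarith); exact r]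
  have r3 : e3 = 1 := by rcases w3 with r | r <;> [(subst r; linarith); exact r]
  subst r1 r2 r3
  have n1neg : n1 < 0 := by
    by_contra! hn
    nlinarith
  nlinarith

theorem Admissible.edge_pos_of_coeff_pos (h : Admissible e1 e2 e3 n1 n2 n3)
    (hA : 0 < n1 ^ 2 - e2 * e3) : 0 < n1 := by
  have := h.edge1
  rcases h.weight2 with r | r <;> rcases h.weight3 with r' | r' <;> rw [r, r'] at this hA <;>
    nlinarith

/-- By `gramDet_mul`, the product with `n1 > 0` is a combination of the nonnegative corner
quantities with nonnegative coefficients. -/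
theorem Admissible.gramDet_nonneg_of_coeff_pos (h : Admissible e1 e2 e3 n1 n2 n3)
    (hA : 0 < n1 ^ 2 - e2 * e3) : 0 ≤ gramDet e1 e2 e3 n1 n2 n3 := by
  have hn := h.edge_pos_of_coeff_pos hA
  have := gramDet_mul e1 e2 e3 n1 n2 n3
  have h1 : 0 ≤ (e2 * n2 + n1 * n3) * (e3 * n3 + n1 * n2) :=
    mul_nonneg (by linarith [h.corner2]) h.corner3
  have h2 := mul_nonneg hA.le h.corner1
  by_contra! hc
  nlinarith

theorem Admissible.height_nonneg_of_coeff_nonpos (h : Admissible e1 e2 e3 n1 n2 n3)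
    (hA : n1 ^ 2 - e2 * e3 ≤ 0) (hx1 : 0 < x1) (hx2 : 0 < x2) (hx3 : 0 < x3) :
    0 ≤ height e2 e3 n1 n2 n3 x1 x2 x3 := by
  unfold height
  have := mul_nonneg (neg_nonneg.2 hA) hx1.le
  have := mul_nonneg h.corner3 hx2.le
  have := mul_nonneg h.corner2 hx3.le
  linarith

/-- The power center lies beyond at most one side: in `coeff_mul_height` both terms on the right are
nonnegative. -/
theorem Admissible.height_nonneg_of_height_nonpos (h : Admissible e1 e2 e3 n1 n2 n3)
    (hA : 0 < n1 ^ 2 - e2 * e3) (hx2 : 0 < x2) (hx3 : 0 < x3)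
    (hH : height e2 e3 n1 n2 n3 x1 x2 x3 ≤ 0) : 0 ≤ height e3 e1 n2 n3 n1 x2 x3 x1 := by
  have hn := h.edge_pos_of_coeff_pos hA
  have hG := h.gramDet_nonneg_of_coeff_pos hA
  have he : 0 ≤ e3 * x2 + n1 * x3 := by
    have : 0 ≤ e3 := by rcases h.weight3 with r | r <;> rw [r]; norm_num
    positivity
  have := coeff_mul_height e1 e2 e3 n1 n2 n3 x1 x2 x3
  have h1 := mul_nonneg hG he
  have h2 := mul_nonneg h.corner3 (neg_nonneg.2 hH)
  by_contra! hc
  nlinarith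

/-- The quadratic form of the derivative of the angles of a triangle, up to a positive factor. -/
def angleForm (lam e1 e2 e3 n1 n2 n3 x1 x2 x3 s1 s2 s3 w1 w2 w3 : ℝ) : ℝ :=
  height e2 e3 n1 n2 n3 x1 x2 x3 / sideSq lam e2 e3 n1 x2 x3 *
      ((x2 * x3 + lam * n1) * (w2 ^ 2 + w3 ^ 2) - 2 * (s2 * s3) * (w2 * w3))
    + height e3 e1 n2 n3 n1 x2 x3 x1 / sideSq lam e3 e1 n2 x3 x1 *
      ((x3 * x1 + lam * n2) * (w3 ^ 2 + w1 ^ 2) - 2 * (s3 * s1) * (w3 * w1))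
    + height e1 e2 n3 n1 n2 x3 x1 x2 / sideSq lam e1 e2 n3 x1 x2 *
      ((x1 * x2 + lam * n3) * (w1 ^ 2 + w2 ^ 2) - 2 * (s1 * s2) * (w1 * w2))

theorem angleForm_rotate (lam e1 e2 e3 n1 n2 n3 x1 x2 x3 s1 s2 s3 w1 w2 w3 : ℝ) :
    angleForm lam e1 e2 e3 n1 n2 n3 x1 x2 x3 s1 s2 s3 w1 w2 w3
      = angleForm lam e2 e3 e1 n2 n3 n1 x2 x3 x1 s2 s3 s1 w2 w3 w1 := by
  unfold angleForm; ring

theorem angleForm_swap (lam e1 e2 e3 n1 n2 n3 x1 x2 x3 s1 s2 s3 w1 w2 w3 : ℝ) :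
    angleForm lam e1 e2 e3 n1 n2 n3 x1 x2 x3 s1 s2 s3 w1 w2 w3
      = angleForm lam e1 e3 e2 n1 n3 n2 x1 x3 x2 s1 s3 s2 w1 w3 w2 := by
  unfold angleForm
  rw [height_swap e3 e2, height_swap e1 e3, height_swap e2 e1, sideSq_swap lam e3 e2,
    sideSq_swap lam e1 e3, sideSq_swap lam e2 e1]
  ring

theorem posDef_two {a b d : ℝ} (ha : 0 ≤ a) (hm : 0 < a * b - d ^ 2) (y z : ℝ) :
    0 < a * y ^ 2 + b * z ^ 2 + 2 * d * (y * z) ∨ y = 0 ∧ z = 0 := by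
  have ha' : 0 < a := by
    rcases ha.eq_or_lt with r | r
    · rw [← r] at hm; nlinarith [sq_nonneg d]
    · exact r
  by_cases hz : z = 0
  · by_cases hy : y = 0
    · exact Or.inr ⟨hy, hz⟩
    · left; subst hz; have := mul_pos ha' (pow_pos (abs_pos.2 hy) 2); rw [sq_abs] at this; nlinarith
  · left
    have : 0 < a * (a * y ^ 2 + b * z ^ 2 + 2 * d * (y * z)) := by
      have h1 : 0 < (a * b - d ^ 2) * z ^ 2 := mul_pos hm (by positivity)
      nlinarith [sq_nonneg (a * y + d * z)]
    exact pos_of_mul_pos_right this ha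

/-- Sylvester's criterion in dimension three. -/
theorem posDef_three {a b c d e f : ℝ} (ha : 0 ≤ a) (hm : 0 < a * b - d ^ 2)
    (hdet : 0 < a * b * c + 2 * (d * e * f) - a * f ^ 2 - b * e ^ 2 - c * d ^ 2) (x y z : ℝ) :
    0 < a * x ^ 2 + b * y ^ 2 + c * z ^ 2 + 2 * d * (x * y) + 2 * e * (x * z) + 2 * f * (y * z) ∨
      x = 0 ∧ y = 0 ∧ z = 0 := by
  have ha' : 0 < a := by
    rcases ha.eq_or_lt with r | r
    · rw [← r] at hm; nlinarith [sq_nonneg d]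
    · exact r
  by_cases hz : z = 0
  · subst hz
    rcases posDef_two ha hm x y with h | h
    · left; linarith
    · exact Or.inr ⟨h.1, h.2, rfl⟩
  · left
    have h1 : 0 < (a * b - d ^ 2) * (a * (a * x ^ 2 + b * y ^ 2 + c * z ^ 2 + 2 * d * (x * y)
        + 2 * e * (x * z) + 2 * f * (y * z))) := by
      -- Completing the square twice writes the quantity as the sum of the terms in `h2`, `h3` and
      -- `h4`.
      have h2 : 0 < a * (a * b * c + 2 * (d * e * f) - a * f ^ 2 - b * e ^ 2 - c * d ^ 2) * z ^ 2 :=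
        mul_pos (mul_pos ha' hdet) (by positivity)
      have h3 := mul_nonneg hm.le (sq_nonneg (a * x + d * y + e * z))
      have h4 := sq_nonneg ((a * b - d ^ 2) * y + (a * f - d * e) * z)
      linarith
    exact pos_of_mul_pos_right (pos_of_mul_pos_right h1 hm.le) ha

end DiscreteConformal

/-! ### Infinitesimal rigidity: definiteness of the angle form. -/

namespace DiscreteConformal

variable {lam e1 e2 e3 n1 n2 n3 x1 x2 x3 : ℝ}

/-- Two expressions of a diagonal entry of the Jacobian: by the heights, and by the chain rule
through the two sides at the vertex. -/
theorem diag_entry_eq (hN3 : sideSq lam e1 e2 n3 x1 x2 ≠ 0) (hN2 : sideSq lam e3 e1 n2 x3 x1 ≠ 0) :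
    height e1 e2 n3 n1 n2 x3 x1 x2 / sideSq lam e1 e2 n3 x1 x2 * (x1 * x2 + lam * n3)
        + height e3 e1 n2 n3 n1 x2 x3 x1 / sideSq lam e3 e1 n2 x3 x1 * (x3 * x1 + lam * n2)
      = cosNum lam e3 n3 n1 n2 x3 x1 x2 * (e1 * x3 + n2 * x1) / sideSq lam e3 e1 n2 x3 x1
        + cosNum lam e2 n2 n3 n1 x2 x3 x1 * (e1 * x2 + n3 * x1) / sideSq lam e1 e2 n3 x1 x2 := by
  have h1 := height_mul_sub_cosNum_mul lam e1 e2 n1 n2 n3 x1 x2 x3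
  have h2 := height_mul_sub_cosNum_mul lam e1 e3 n1 n3 n2 x1 x3 x2
  rw [height_swap e1 e3, sideSq_swap lam e1 e3, cosNum_swap] at h2
  field_simp
  linear_combination sideSq lam e3 e1 n2 x3 x1 * h1 + sideSq lam e1 e2 n3 x1 x2 * h2

/-- The leading minor of order two of the angle form. -/
theorem minor_eq (hN1 : sideSq lam e2 e3 n1 x2 x3 ≠ 0) (hN2 : sideSq lam e3 e1 n2 x3 x1 ≠ 0)
    (hN3 : sideSq lam e1 e2 n3 x1 x2 ≠ 0) :
    x3 * (sideSq lam e2 e3 n1 x2 x3 * sideSq lam e3 e1 n2 x3 x1 * sideSq lam e1 e2 n3 x1 x2) *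
      ((height e1 e2 n3 n1 n2 x3 x1 x2 / sideSq lam e1 e2 n3 x1 x2 * (x1 * x2 + lam * n3)
          + height e3 e1 n2 n3 n1 x2 x3 x1 / sideSq lam e3 e1 n2 x3 x1 * (x3 * x1 + lam * n2)) *
        (height e1 e2 n3 n1 n2 x3 x1 x2 / sideSq lam e1 e2 n3 x1 x2 * (x1 * x2 + lam * n3)
          + height e2 e3 n1 n2 n3 x1 x2 x3 / sideSq lam e2 e3 n1 x2 x3 * (x2 * x3 + lam * n1))
        - (x1 ^ 2 - lam * e1) * (x2 ^ 2 - lam * e2) *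
          (height e1 e2 n3 n1 n2 x3 x1 x2 / sideSq lam e1 e2 n3 x1 x2) ^ 2)
      = areaSq lam e1 e2 e3 n1 n2 n3 x1 x2 x3 *
        ((x2 * x3 + lam * n1) * (x3 * x1 + lam * n2) * cyclicSum e1 e2 e3 n1 n2 n3 x1 x2 x3
          + lam * (x3 ^ 2 - lam * e3) * ((e2 * x3 + n1 * x2) * (e1 * x3 + n2 * x1)) *
            height e1 e2 n3 n1 n2 x3 x1 x2) := by
  have d1 := diag_entry_eq (e3 := e3) (n1 := n1) hN3 hN2
  have d2 := diag_entry_eq (e3 := e1) (n1 := n2) hN1 hN3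
  rw [add_comm] at d2
  rw [d1, d2]
  have o1 := sideSq_mul_sub_cosNum_mul lam e1 e2 n1 n2 n3 x1 x2 x3
  have o2 := sideSq_mul_sub_cosNum_mul lam e2 e1 n2 n1 n3 x2 x1 x3
  rw [sideSq_swap lam e2 e1, cosNum_swap, height_swap e2 e1] at o2
  have o : (x1 ^ 2 - lam * e1) * (x2 ^ 2 - lam * e2) *
      (height e1 e2 n3 n1 n2 x3 x1 x2 / sideSq lam e1 e2 n3 x1 x2) ^ 2
      = (sideSq lam e1 e2 n3 x1 x2 * (e1 * x3 + n2 * x1)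
        - cosNum lam e1 n1 n2 n3 x1 x2 x3 * (e1 * x2 + n3 * x1)) *
        (sideSq lam e1 e2 n3 x1 x2 * (e2 * x3 + n1 * x2)
        - cosNum lam e2 n2 n3 n1 x2 x3 x1 * (e2 * x1 + n3 * x2)) /
          sideSq lam e1 e2 n3 x1 x2 ^ 2 := by
    rw [o1, o2]; field_simp
  rw [o]
  have q1 := cosNum_mul_cosNum_add lam e3 e1 e2 n3 n1 n2 x3 x1 x2
  have q2 := cosNum_mul_cosNum_add lam e2 e3 e1 n2 n3 n1 x2 x3 x1
  have q3 := sideSq_mul_sideSq_sub_cosNum_sq lam e3 e1 e2 n3 n1 n2 x3 x1 x2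
  rw [← areaSq_rotate, ← areaSq_rotate] at q1
  rw [← areaSq_rotate] at q2
  rw [← areaSq_rotate, ← areaSq_rotate] at q3
  -- The factor `x3` in the statement is there for these three identities, which eliminate the
  -- squared sides left over after `step`.
  have r1 := sideSq_eq_mixed lam e1 e3 n2 x1 x3
  have r2 := sideSq_eq_mixed lam e2 e3 n1 x2 x3
  have r3 := height_eq_mixed lam e1 e2 n1 n2 n3 x1 x2 x3
  rw [sideSq_swap lam e3 e2] at r2
  generalize hW : cyclicSum e1 e2 e3 n1 n2 n3 x1 x2 x3 = W
  unfold cyclicSum at hW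
  generalize areaSq lam e1 e2 e3 n1 n2 n3 x1 x2 x3 = Q at *
  generalize sideSq lam e2 e3 n1 x2 x3 = N1 at *
  generalize sideSq lam e3 e1 n2 x3 x1 = N2 at *
  generalize sideSq lam e1 e2 n3 x1 x2 = N3 at *
  generalize cosNum lam e1 n1 n2 n3 x1 x2 x3 = P1 at *
  generalize cosNum lam e2 n2 n3 n1 x2 x3 x1 = P2 at *
  generalize cosNum lam e3 n3 n1 n2 x3 x1 x2 = P3 at *
  generalize height e1 e2 n3 n1 n2 x3 x1 x2 = H3 at *
  -- After expansion, the terms quadratic in the cosines group into the left sides of `q1`, `q2` and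
  -- `q3`; each is a multiple of the area `Q`, which therefore factors out.
  have step : N1 * N2 * N3 *
      ((P3 * (e1 * x3 + n2 * x1) / N2 + P2 * (e1 * x2 + n3 * x1) / N3) *
          (P1 * (e2 * x1 + n3 * x2) / N3 + P3 * (e2 * x3 + n1 * x2) / N1)
        - (N3 * (e1 * x3 + n2 * x1) - P1 * (e1 * x2 + n3 * x1)) *
          (N3 * (e2 * x3 + n1 * x2) - P2 * (e2 * x1 + n3 * x2)) / N3 ^ 2)
      = Q * ((x3 * x1 + lam * n2) * (e1 * x3 + n2 * x1) * (e2 * x1 + n3 * x2) * N1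
        + (x2 * x3 + lam * n1) * (e2 * x3 + n1 * x2) * (e1 * x2 + n3 * x1) * N2
        - (x3 ^ 2 - lam * e3) * (e1 * x3 + n2 * x1) * (e2 * x3 + n1 * x2) * N3) := by
    field_simp
    linear_combination N3 * N1 * ((e1 * x3 + n2 * x1) * (e2 * x1 + n3 * x2)) * q1
      + N3 * N2 * ((e1 * x2 + n3 * x1) * (e2 * x3 + n1 * x2)) * q2
      - N3 ^ 2 * ((e1 * x3 + n2 * x1) * (e2 * x3 + n1 * x2)) * q3
  rw [mul_assoc x3, step]
  subst hW
  linear_combination Q * ((x3 * x1 + lam * n2) * (e1 * x3 + n2 * x1) * (e2 * x1 + n3 * x2) * r2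
    + (x2 * x3 + lam * n1) * (e2 * x3 + n1 * x2) * (e1 * x2 + n3 * x1) * r1
    + (x3 ^ 2 - lam * e3) * ((e1 * x3 + n2 * x1) * (e2 * x3 + n1 * x2)) * r3)

/-- The determinant of the hyperbolic angle form. -/
theorem det_eq (hN1 : sideSq 1 e2 e3 n1 x2 x3 ≠ 0) (hN2 : sideSq 1 e3 e1 n2 x3 x1 ≠ 0)
    (hN3 : sideSq 1 e1 e2 n3 x1 x2 ≠ 0) (c1 c2 c3 : ℝ)
    (h1 : c1 = height e2 e3 n1 n2 n3 x1 x2 x3 / sideSq 1 e2 e3 n1 x2 x3)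
    (h2 : c2 = height e3 e1 n2 n3 n1 x2 x3 x1 / sideSq 1 e3 e1 n2 x3 x1)
    (h3 : c3 = height e1 e2 n3 n1 n2 x3 x1 x2 / sideSq 1 e1 e2 n3 x1 x2) :
    !![c3 * (x1 * x2 + 1 * n3) + c2 * (x3 * x1 + 1 * n2), -(x2 ^ 2 - 1 * e2) * c3,
        -(x3 ^ 2 - 1 * e3) * c2;
      -(x1 ^ 2 - 1 * e1) * c3, c1 * (x2 * x3 + 1 * n1) + c3 * (x1 * x2 + 1 * n3),
        -(x3 ^ 2 - 1 * e3) * c1;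
      -(x1 ^ 2 - 1 * e1) * c2, -(x2 ^ 2 - 1 * e2) * c1,
        c2 * (x3 * x1 + 1 * n2) + c1 * (x2 * x3 + 1 * n1)].det
      = areaSq 1 e1 e2 e3 n1 n2 n3 x1 x2 x3 ^ 2 * cyclicSum e1 e2 e3 n1 n2 n3 x1 x2 x3 /
        (sideSq 1 e2 e3 n1 x2 x3 * sideSq 1 e3 e1 n2 x3 x1 * sideSq 1 e1 e2 n3 x1 x2) := by
  have d1 := diag_entry_eq (e3 := e3) (n1 := n1) hN3 hN2
  have d2 := diag_entry_eq (e3 := e1) (n1 := n2) hN1 hN3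
  have d3 := diag_entry_eq (e3 := e2) (n1 := n3) hN2 hN1
  rw [← h3, ← h2] at d1
  rw [← h3, ← h1] at d2
  rw [← h1, ← h2] at d3
  have o12 := sideSq_mul_sub_cosNum_mul 1 e2 e1 n2 n1 n3 x2 x1 x3
  have o21 := sideSq_mul_sub_cosNum_mul 1 e1 e2 n1 n2 n3 x1 x2 x3
  have o23 := sideSq_mul_sub_cosNum_mul 1 e3 e2 n3 n2 n1 x3 x2 x1
  have o32 := sideSq_mul_sub_cosNum_mul 1 e2 e3 n2 n3 n1 x2 x3 x1
  have o31 := sideSq_mul_sub_cosNum_mul 1 e1 e3 n1 n3 n2 x1 x3 x2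
  have o13 := sideSq_mul_sub_cosNum_mul 1 e3 e1 n3 n1 n2 x3 x1 x2
  rw [sideSq_swap 1 e2 e1, cosNum_swap, height_swap e2 e1] at o12
  rw [sideSq_swap 1 e3 e2, cosNum_swap, height_swap e3 e2] at o23
  rw [sideSq_swap 1 e1 e3, cosNum_swap, height_swap e1 e3] at o31
  -- The adjugate of this matrix consists of the squared sides and the cosines. It plays the part of
  -- the derivative of the angles by the sides, and its determinant is the square of that of the
  -- matrix.
  have hB : (!![x1 ^ 2 - 1 * e1, x1 * x2 + 1 * n3, x3 * x1 + 1 * n2;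
      x1 * x2 + 1 * n3, x2 ^ 2 - 1 * e2, x2 * x3 + 1 * n1;
      x3 * x1 + 1 * n2, x2 * x3 + 1 * n1, x3 ^ 2 - 1 * e3]).det
      = areaSq 1 e1 e2 e3 n1 n2 n3 x1 x2 x3 := by
    rw [Matrix.det_fin_three]
    simp [areaSq, height, gramDet]
    ring
  have hadj : (!![-sideSq 1 e2 e3 n1 x2 x3, cosNum 1 e3 n3 n1 n2 x3 x1 x2,
        cosNum 1 e2 n2 n3 n1 x2 x3 x1;
      cosNum 1 e3 n3 n1 n2 x3 x1 x2, -sideSq 1 e3 e1 n2 x3 x1, cosNum 1 e1 n1 n2 n3 x1 x2 x3;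
      cosNum 1 e2 n2 n3 n1 x2 x3 x1, cosNum 1 e1 n1 n2 n3 x1 x2 x3,
        -sideSq 1 e1 e2 n3 x1 x2]).det
      = areaSq 1 e1 e2 e3 n1 n2 n3 x1 x2 x3 ^ 2 := by
    have hd := Matrix.det_adjugate !![x1 ^ 2 - 1 * e1, x1 * x2 + 1 * n3, x3 * x1 + 1 * n2;
      x1 * x2 + 1 * n3, x2 ^ 2 - 1 * e2, x2 * x3 + 1 * n1;
      x3 * x1 + 1 * n2, x2 * x3 + 1 * n1, x3 ^ 2 - 1 * e3]
    rw [hB, Matrix.adjugate_fin_three_of, Fintype.card_fin] at hd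
    refine Eq.trans ?_ hd
    congr 1
    ext i j
    fin_cases i <;> fin_cases j <;> simp [sideSq, cosNum] <;> ring
  -- The derivative of the sides by the vertex coordinates, up to nonzero factors. The diagonal
  -- vanishes because a side does not depend on the opposite vertex.
  have hR : (!![0, (e2 * x3 + n1 * x2) / sideSq 1 e2 e3 n1 x2 x3,
        (e3 * x2 + n1 * x3) / sideSq 1 e2 e3 n1 x2 x3;
      (e1 * x3 + n2 * x1) / sideSq 1 e3 e1 n2 x3 x1, 0,
        (e3 * x1 + n2 * x3) / sideSq 1 e3 e1 n2 x3 x1;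
      (e1 * x2 + n3 * x1) / sideSq 1 e1 e2 n3 x1 x2,
        (e2 * x1 + n3 * x2) / sideSq 1 e1 e2 n3 x1 x2, 0]).det
      = cyclicSum e1 e2 e3 n1 n2 n3 x1 x2 x3 /
        (sideSq 1 e2 e3 n1 x2 x3 * sideSq 1 e3 e1 n2 x3 x1 * sideSq 1 e1 e2 n3 x1 x2) := by
    rw [Matrix.det_fin_three]
    simp [cyclicSum]
    field_simp
  rw [mul_div_assoc, ← hadj, ← hR, ← Matrix.det_mul]
  congr 1
  generalize sideSq 1 e2 e3 n1 x2 x3 = N1 at *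
  generalize sideSq 1 e3 e1 n2 x3 x1 = N2 at *
  generalize sideSq 1 e1 e2 n3 x1 x2 = N3 at *
  generalize cosNum 1 e1 n1 n2 n3 x1 x2 x3 = P1 at *
  generalize cosNum 1 e2 n2 n3 n1 x2 x3 x1 = P2 at *
  generalize cosNum 1 e3 n3 n1 n2 x3 x1 x2 = P3 at *
  rw [Matrix.mul_fin_three]
  ext i j
  fin_cases i <;> fin_cases j
  · exact d1.trans (by simp; ring)
  · have := (eq_div_iff hN3).1 h3
    rw [← this] at o12
    simp
    field_simp
    linear_combination o12
  · have := (eq_div_iff hN2).1 h2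
    rw [← this] at o13
    simp
    field_simp
    linear_combination o13
  · have := (eq_div_iff hN3).1 h3
    rw [← this] at o21
    simp
    field_simp
    linear_combination o21
  · exact d2.trans (by simp; ring)
  · have := (eq_div_iff hN1).1 h1
    rw [← this] at o23
    simp
    field_simp
    linear_combination o23
  · have := (eq_div_iff hN2).1 h2
    rw [← this] at o31
    simp
    field_simp
    linear_combination o31
  · have := (eq_div_iff hN1).1 h1
    rw [← this] at o32
    simp
    field_simp
    linear_combination o32
  · exact d3.trans (by simp; ring)

/-- The angle form is nonnegative, and definite up to the evident kernel. -/
def FormDefinite (lam e1 e2 e3 n1 n2 n3 x1 x2 x3 s1 s2 s3 w1 w2 w3 : ℝ) : Prop :=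
  0 < angleForm lam e1 e2 e3 n1 n2 n3 x1 x2 x3 s1 s2 s3 w1 w2 w3 ∨
    angleForm lam e1 e2 e3 n1 n2 n3 x1 x2 x3 s1 s2 s3 w1 w2 w3 = 0 ∧ w1 = w2 ∧ w2 = w3 ∧
      (lam = 1 → w1 = 0)

variable {s1 s2 s3 w1 w2 w3 : ℝ}

theorem FormDefinite.rotate
    (h : FormDefinite lam e1 e2 e3 n1 n2 n3 x1 x2 x3 s1 s2 s3 w1 w2 w3) :
    FormDefinite lam e2 e3 e1 n2 n3 n1 x2 x3 x1 s2 s3 s1 w2 w3 w1 := by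
  unfold FormDefinite
  rw [← angleForm_rotate]
  refine h.imp id fun ⟨a, b, c, d⟩ => ⟨a, c, (b.trans c).symm, fun hl => b ▸ d hl⟩

theorem FormDefinite.swap
    (h : FormDefinite lam e1 e2 e3 n1 n2 n3 x1 x2 x3 s1 s2 s3 w1 w2 w3) :
    FormDefinite lam e1 e3 e2 n1 n3 n2 x1 x3 x2 s1 s3 s2 w1 w3 w2 := by
  unfold FormDefinite
  rw [← angleForm_swap]
  refine h.imp id fun ⟨a, b, c, d⟩ => ⟨a, b.trans c, c.symm, d⟩

theorem weight_nonneg (h : e1 = 0 ∨ e1 = 1) : 0 ≤ e1 := by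
  rcases h with h | h <;> rw [h]; norm_num

/-- Sylvester's criterion in the order 1, 2, 3. The sign hypotheses serve the first two minors:
`hH2` and `hH3` make the first diagonal entry nonnegative, while `hn1`, `hn2` and `hH3` make the
hyperbolic correction term of `minor_eq` nonnegative. The determinant needs no such hypotheses. -/
theorem formDefinite_of_nonneg (hl : lam = 0 ∨ lam = 1) (h : Admissible e1 e2 e3 n1 n2 n3)
    (hx1 : InRange lam e1 x1) (hx2 : InRange lam e2 x2) (hx3 : InRange lam e3 x3)
    (hs1 : 0 < s1) (hs2 : 0 < s2) (hs3 : 0 < s3)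
    (hs1' : s1 ^ 2 = x1 ^ 2 - lam * e1) (hs2' : s2 ^ 2 = x2 ^ 2 - lam * e2)
    (hs3' : s3 ^ 2 = x3 ^ 2 - lam * e3)
    (hQ : 0 < areaSq lam e1 e2 e3 n1 n2 n3 x1 x2 x3)
    (hn1 : 0 ≤ n1) (hn2 : 0 ≤ n2) (hH2 : 0 ≤ height e3 e1 n2 n3 n1 x2 x3 x1)
    (hH3 : 0 ≤ height e1 e2 n3 n1 n2 x3 x1 x2) :
    FormDefinite lam e1 e2 e3 n1 n2 n3 x1 x2 x3 s1 s2 s3 w1 w2 w3 := by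
  have hN1 := sideSq_pos hl h.weight2 h.weight3 h.edge1 hx2 hx3
  have hN2 := sideSq_pos hl h.weight3 h.weight1 h.edge2 hx3 hx1
  have hN3 := sideSq_pos hl h.weight1 h.weight2 h.edge3 hx1 hx2
  have hp1 := mixed_pos hl h.weight2 h.weight3 h.edge1 hx2 hx3
  have hp2 := mixed_pos hl h.weight3 h.weight1 h.edge2 hx3 hx1
  have hp3 := mixed_pos hl h.weight1 h.weight2 h.edge3 hx1 hx2
  have hW := cyclicSum_pos h hx1.pos hx2.pos hx3.pos
  have hm := minor_eq hN1.ne' hN2.ne' hN3.ne'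
  have hlam : 0 ≤ lam := weight_nonneg hl
  have he1 := weight_nonneg h.weight1
  have he2 := weight_nonneg h.weight2
  have q1 := hx1.pos
  have q2 := hx2.pos
  have q3 := hx3.pos
  have hdet := det_eq (e1 := e1) (e2 := e2) (e3 := e3) (n1 := n1) (n2 := n2) (n3 := n3) (x1 := x1)
    (x2 := x2) (x3 := x3)
  unfold FormDefinite angleForm
  have hpos : 0 < areaSq lam e1 e2 e3 n1 n2 n3 x1 x2 x3 *
        ((x2 * x3 + lam * n1) * (x3 * x1 + lam * n2) * cyclicSum e1 e2 e3 n1 n2 n3 x1 x2 x3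
          + lam * (x3 ^ 2 - lam * e3) * ((e2 * x3 + n1 * x2) * (e1 * x3 + n2 * x1)) *
            height e1 e2 n3 n1 n2 x3 x1 x2) := by
    have := hx3.sq_sub_pos
    positivity
  rw [← hm] at hpos
  have hpos' := pos_of_mul_pos_right hpos (by positivity)
  clear hm hpos
  rcases hl with rfl | rfl
  -- In the Euclidean case `s = x`, and the form depends only on the differences of the `w_i`, so a
  -- form in the two variables `w1 - w3` and `w2 - w3` remains.
  · have t1 : x1 ^ 2 = s1 ^ 2 := by linarith
    have t2 : x2 ^ 2 = s2 ^ 2 := by linarith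
    have t3 : x3 ^ 2 = s3 ^ 2 := by linarith
    rw [sq_eq_sq₀ hx1.pos.le hs1.le] at t1
    rw [sq_eq_sq₀ hx2.pos.le hs2.le] at t2
    rw [sq_eq_sq₀ hx3.pos.le hs3.le] at t3
    subst t1 t2 t3
    clear hdet
    have hc2 := div_nonneg hH2 hN2.le
    have hc3 := div_nonneg hH3 hN3.le
    generalize height e2 e3 n1 n2 n3 x1 x2 x3 / sideSq 0 e2 e3 n1 x2 x3 = c1 at *
    generalize height e3 e1 n2 n3 n1 x2 x3 x1 / sideSq 0 e3 e1 n2 x3 x1 = c2 at *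
    generalize height e1 e2 n3 n1 n2 x3 x1 x2 / sideSq 0 e1 e2 n3 x1 x2 = c3 at *
    rcases posDef_two (a := c3 * (x1 * x2) + c2 * (x3 * x1)) (b := c3 * (x1 * x2) + c1 * (x2 * x3))
      (d := -(c3 * (x1 * x2))) (by positivity) (by linarith) (w1 - w3) (w2 - w3) with r | ⟨r, r'⟩
    · left; linarith
    · have r1 : w1 = w3 := by linarith
      have r2 : w2 = w3 := by linarith
      subst r1 r2
      right
      refine ⟨by ring, rfl, rfl, fun h => by norm_num at h⟩
  · specialize hdet hN1.ne' hN2.ne' hN3.ne' _ _ _ rfl rfl rfl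
    have hd : 0 < areaSq 1 e1 e2 e3 n1 n2 n3 x1 x2 x3 ^ 2 * cyclicSum e1 e2 e3 n1 n2 n3 x1 x2 x3 /
        (sideSq 1 e2 e3 n1 x2 x3 * sideSq 1 e3 e1 n2 x3 x1 * sideSq 1 e1 e2 n3 x1 x2) := by
      positivity
    rw [← hdet, Matrix.det_fin_three] at hd
    have hc2 := div_nonneg hH2 hN2.le
    have hc3 := div_nonneg hH3 hN3.le
    generalize height e2 e3 n1 n2 n3 x1 x2 x3 / sideSq 1 e2 e3 n1 x2 x3 = c1 at *
    generalize height e3 e1 n2 n3 n1 x2 x3 x1 / sideSq 1 e3 e1 n2 x3 x1 = c2 at *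
    generalize height e1 e2 n3 n1 n2 x3 x1 x2 / sideSq 1 e1 e2 n3 x1 x2 = c3 at *
    -- The matrix of `det_eq` is conjugate, by the diagonal matrix of the `s_i`, to the symmetric
    -- matrix of the form, so the two determinants agree.
    rw [← hs1', ← hs2', ← hs3'] at hd
    rw [← hs1', ← hs2'] at hpos'
    simp at hd
    rcases posDef_three (a := c3 * (x1 * x2 + 1 * n3) + c2 * (x3 * x1 + 1 * n2))
      (b := c3 * (x1 * x2 + 1 * n3) + c1 * (x2 * x3 + 1 * n1))
      (c := c2 * (x3 * x1 + 1 * n2) + c1 * (x2 * x3 + 1 * n1))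
      (d := -(c3 * (s1 * s2))) (e := -(c2 * (s3 * s1))) (f := -(c1 * (s2 * s3)))
      (by positivity) (by linarith) (by linarith) w1 w2 w3 with r | ⟨r1, r2, r3⟩
    · left; linarith
    · subst r1 r2 r3
      right
      simp

/-- A negative height at the vertex 1 forces `n1 > 0` and makes the other heights nonnegative. One
of `n2` and `n3` is nonnegative, and a swap of the vertices 2 and 3 lets it be `n2`. -/
theorem formDefinite_of_height_neg (hl : lam = 0 ∨ lam = 1) (h : Admissible e1 e2 e3 n1 n2 n3)
    (hx1 : InRange lam e1 x1) (hx2 : InRange lam e2 x2) (hx3 : InRange lam e3 x3)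
    (hs1 : 0 < s1) (hs2 : 0 < s2) (hs3 : 0 < s3)
    (hs1' : s1 ^ 2 = x1 ^ 2 - lam * e1) (hs2' : s2 ^ 2 = x2 ^ 2 - lam * e2)
    (hs3' : s3 ^ 2 = x3 ^ 2 - lam * e3)
    (hQ : 0 < areaSq lam e1 e2 e3 n1 n2 n3 x1 x2 x3)
    (hH1 : height e2 e3 n1 n2 n3 x1 x2 x3 < 0) :
    FormDefinite lam e1 e2 e3 n1 n2 n3 x1 x2 x3 s1 s2 s3 w1 w2 w3 := by
  have hA : 0 < n1 ^ 2 - e2 * e3 := by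
    by_contra! hA
    exact hH1.not_ge (h.height_nonneg_of_coeff_nonpos hA hx1.pos hx2.pos hx3.pos)
  have hn := h.edge_pos_of_coeff_pos hA
  have hH2 := h.height_nonneg_of_height_nonpos hA hx2.pos hx3.pos hH1.le
  have hH3 := h.swap.height_nonneg_of_height_nonpos (by linarith) hx3.pos hx2.pos
    (by rw [height_swap]; exact hH1.le)
  rcases h.nonneg_or_nonneg with hn2 | hn3
  · refine formDefinite_of_nonneg hl h hx1 hx2 hx3 hs1 hs2 hs3 hs1' hs2' hs3' hQ hn.le hn2 hH2 ?_
    rw [height_swap]; exact hH3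
  · refine FormDefinite.swap (formDefinite_of_nonneg hl h.swap hx1 hx3 hx2 hs1 hs3 hs2 hs1' hs3'
      hs2' (by rwa [areaSq_swap]) hn.le hn3 hH3 ?_)
    rw [height_swap]; exact hH2

theorem formDefinite (hl : lam = 0 ∨ lam = 1) (h : Admissible e1 e2 e3 n1 n2 n3)
    (hx1 : InRange lam e1 x1) (hx2 : InRange lam e2 x2) (hx3 : InRange lam e3 x3)
    (hs1 : 0 < s1) (hs2 : 0 < s2) (hs3 : 0 < s3)
    (hs1' : s1 ^ 2 = x1 ^ 2 - lam * e1) (hs2' : s2 ^ 2 = x2 ^ 2 - lam * e2)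
    (hs3' : s3 ^ 2 = x3 ^ 2 - lam * e3)
    (hQ : 0 < areaSq lam e1 e2 e3 n1 n2 n3 x1 x2 x3) :
    FormDefinite lam e1 e2 e3 n1 n2 n3 x1 x2 x3 s1 s2 s3 w1 w2 w3 := by
  have hQ2 := hQ
  rw [areaSq_rotate] at hQ2
  have hQ3 := hQ2
  rw [areaSq_rotate] at hQ3
  by_cases c1 : height e2 e3 n1 n2 n3 x1 x2 x3 < 0
  · exact formDefinite_of_height_neg hl h hx1 hx2 hx3 hs1 hs2 hs3 hs1' hs2' hs3' hQ c1
  by_cases c2 : height e3 e1 n2 n3 n1 x2 x3 x1 < 0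
  · exact (formDefinite_of_height_neg hl h.rotate hx2 hx3 hx1 hs2 hs3 hs1 hs2' hs3' hs1' hQ2
      c2).rotate.rotate
  by_cases c3 : height e1 e2 n3 n1 n2 x3 x1 x2 < 0
  · exact (formDefinite_of_height_neg hl h.rotate.rotate hx3 hx1 hx2 hs3 hs1 hs2 hs3' hs1' hs2' hQ3
      c3).rotate
  push Not at c1 c2 c3
  -- All heights are now nonnegative; the vertices are rotated so that an edge weight that may be
  -- negative comes third.
  by_cases k1 : n1 < 0
  · exact (formDefinite_of_nonneg hl h.rotate hx2 hx3 hx1 hs2 hs3 hs1 hs2' hs3' hs1' hQ2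
      (by rcases h.rotate.rotate.nonneg_or_nonneg with r | r <;> linarith)
      (by rcases h.rotate.nonneg_or_nonneg with r | r <;> linarith) c3 c1).rotate.rotate
  by_cases k2 : n2 < 0
  · exact (formDefinite_of_nonneg hl h.rotate.rotate hx3 hx1 hx2 hs3 hs1 hs2 hs3' hs1' hs2' hQ3
      (by rcases h.nonneg_or_nonneg with r | r <;> linarith) (by linarith) c1 c2).rotate
  exact formDefinite_of_nonneg hl h hx1 hx2 hx3 hs1 hs2 hs3 hs1' hs2' hs3' hQ (by linarith)
    (by linarith) c2 c3

end DiscreteConformal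

/-! ### Degenerate triangles: which angle becomes flat. -/

namespace DiscreteConformal

variable {lam e1 e2 e3 n1 n2 n3 x1 x2 x3 : ℝ}

theorem cosNum_pos_of_nonpos (hl : lam = 0 ∨ lam = 1) (h : Admissible e1 e2 e3 n1 n2 n3)
    (hx1 : InRange lam e1 x1) (hx2 : InRange lam e2 x2) (hx3 : InRange lam e3 x3)
    (hP : cosNum lam e1 n1 n2 n3 x1 x2 x3 ≤ 0) : 0 < cosNum lam e3 n3 n1 n2 x3 x1 x2 := by
  have hN2 := sideSq_pos hl h.weight3 h.weight1 h.edge2 hx3 hx1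
  have hp2 := mixed_pos hl h.weight3 h.weight1 h.edge2 hx3 hx1
  have hp3 := mixed_pos hl h.weight1 h.weight2 h.edge3 hx1 hx2
  have := cosNum_add_cosNum lam e1 e3 n1 n2 n3 x1 x2 x3
  have h1 := mul_pos hp3 hN2
  have h2 := mul_nonneg hp2.le (neg_nonneg.2 hP)
  have h3 := hx1.sq_sub_pos
  by_contra! hc
  nlinarith

/-- A negative value would force `n3 < 0`, hence `e2 = 1`, and `x1 < -n3 * x2`. But the height
condition gives `(n1² - e3) * x1 ≥ (e3 * n3 + n1 * n2) * x2`, and `e3 * n3 + n1 * n2 + n3 * (n1² -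
e3) = n1 * (n2 + n1 * n3) ≥ 0` contradicts this. -/
theorem derivative_nonneg_of_height_nonpos (h : Admissible e1 e2 e3 n1 n2 n3)
    (hx2 : 0 < x2) (hx3 : 0 < x3) (hA : 0 < n1 ^ 2 - e2 * e3)
    (hH : height e2 e3 n1 n2 n3 x1 x2 x3 ≤ 0) (hx1 : 0 < x1) : 0 ≤ e2 * x1 + n3 * x2 := by
  by_contra! hc
  have hn := h.edge_pos_of_coeff_pos hA
  have hn3 : n3 < 0 := by
    have := mul_nonneg (weight_nonneg h.weight2) hx1.le
    by_contra! hh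
    nlinarith
  have hd := h.edge3
  have r2 : e2 = 1 := by
    rcases h.weight2 with r | r
    · rw [r] at hd; linarith
    · exact r
  have c2 := h.corner2
  subst r2
  unfold height at hH
  have k1 := mul_pos hA (show 0 < -(x1 + n3 * x2) by linarith)
  have k2 := mul_nonneg (mul_nonneg hx2.le hn.le) c2
  have k3 := mul_nonneg c2 hx3.le
  nlinarith

theorem cosNum_nonneg_of_height_nonpos (hl : lam = 0 ∨ lam = 1)
    (h : Admissible e1 e2 e3 n1 n2 n3)
    (hx1 : InRange lam e1 x1) (hx2 : InRange lam e2 x2) (hx3 : InRange lam e3 x3)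
    (hA : 0 < n1 ^ 2 - e2 * e3) (hH : height e2 e3 n1 n2 n3 x1 x2 x3 ≤ 0) :
    0 ≤ cosNum lam e2 n2 n3 n1 x2 x3 x1 := by
  have hn := h.edge_pos_of_coeff_pos hA
  have hN1 := sideSq_pos hl h.weight2 h.weight3 h.edge1 hx2 hx3
  have he := derivative_nonneg_of_height_nonpos h hx2.pos hx3.pos hA hH hx1.pos
  have hid := sideSq_mul_sub_cosNum_mul lam e2 e3 n2 n3 n1 x2 x3 x1
  have k1 := mul_nonneg hN1.le he
  have k2 := mul_nonneg hx2.sq_sub_pos.le (neg_nonneg.2 hH)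
  have k3 : 0 < e2 * x3 + n1 * x2 := by
    have := mul_nonneg (weight_nonneg h.weight2) hx3.pos.le
    have := mul_pos hn hx2.pos
    linarith
  by_contra! hc
  nlinarith

/-- The other two cosines are nonnegative. If the first were too, the second cosine law with
nonpositive area would make both of them nonpositive, whereas two angles cannot both be right or
obtuse. -/
theorem cosNum_neg_of_height_nonpos (hl : lam = 0 ∨ lam = 1) (h : Admissible e1 e2 e3 n1 n2 n3)
    (hx1 : InRange lam e1 x1) (hx2 : InRange lam e2 x2) (hx3 : InRange lam e3 x3)
    (hQ : areaSq lam e1 e2 e3 n1 n2 n3 x1 x2 x3 ≤ 0)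
    (hA : 0 < n1 ^ 2 - e2 * e3) (hH : height e2 e3 n1 n2 n3 x1 x2 x3 ≤ 0) :
    cosNum lam e1 n1 n2 n3 x1 x2 x3 < 0 := by
  have hP2 := cosNum_nonneg_of_height_nonpos hl h hx1 hx2 hx3 hA hH
  have hP3 := cosNum_nonneg_of_height_nonpos hl h.swap hx1 hx3 hx2 (by linarith)
    (by rwa [height_swap])
  rw [cosNum_swap] at hP3
  by_contra! hP1
  have hN3 := sideSq_pos hl h.weight1 h.weight2 h.edge3 hx1 hx2
  have hp3 := mixed_pos hl h.weight1 h.weight2 h.edge3 hx1 hx2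
  have hid := cosNum_mul_cosNum_add lam e1 e2 e3 n1 n2 n3 x1 x2 x3
  have hP3' : cosNum lam e3 n3 n1 n2 x3 x1 x2 ≤ 0 := by
    have k1 := mul_nonneg hP1 hP2
    have k2 := mul_nonneg hp3.le (neg_nonneg.2 hQ)
    by_contra! hc
    nlinarith
  have hN2 := sideSq_pos hl h.weight3 h.weight1 h.edge2 hx3 hx1
  have hp2 := mixed_pos hl h.weight3 h.weight1 h.edge2 hx3 hx1
  have hid := cosNum_mul_cosNum_add lam e3 e1 e2 n3 n1 n2 x3 x1 x2
  rw [← areaSq_rotate, ← areaSq_rotate] at hid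
  have k1 := mul_nonneg hP1 hP3
  have k2 := mul_nonneg hp2.le (neg_nonneg.2 hQ)
  have := cosNum_pos_of_nonpos hl h.rotate.rotate hx3 hx1 hx2 hP3'
  nlinarith

theorem weights_eq_one_of_coeff_nonpos (h : Admissible e1 e2 e3 n1 n2 n3)
    (hA : n1 ^ 2 - e2 * e3 ≤ 0) : e2 = 1 ∧ e3 = 1 := by
  have hd := h.edge1
  rcases h.weight2 with r | r <;> rcases h.weight3 with r' | r' <;> rw [r, r'] at hA hd
  · nlinarith
  · nlinarith
  · nlinarith
  · exact ⟨r, r'⟩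

/-- The case of three circles meeting in pairs: all vertex weights are `1` and all `|n_i| ≤ 1`, and
such a triangle never degenerates, because the area polynomial in the `x_i` has nonnegative
coefficients apart from its constant term. -/
theorem areaSq_pos_of_coeff_nonpos (hl : lam = 0 ∨ lam = 1) (h : Admissible e1 e2 e3 n1 n2 n3)
    (hx1 : InRange lam e1 x1) (hx2 : InRange lam e2 x2) (hx3 : InRange lam e3 x3)
    (hA1 : n1 ^ 2 - e2 * e3 ≤ 0) (hA2 : n2 ^ 2 - e3 * e1 ≤ 0) (hA3 : n3 ^ 2 - e1 * e2 ≤ 0) :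
    0 < areaSq lam e1 e2 e3 n1 n2 n3 x1 x2 x3 := by
  obtain ⟨r2, r3⟩ := weights_eq_one_of_coeff_nonpos h hA1
  obtain ⟨-, r1⟩ := weights_eq_one_of_coeff_nonpos h.rotate hA2
  subst r1 r2 r3
  obtain ⟨-, -, -, d1, d2, d3, c1, c2, c3⟩ := h
  have hG : areaSq lam 1 1 1 n1 n2 n3 x1 x2 x3 = (1 - n1 ^ 2) * x1 ^ 2 + (1 - n2 ^ 2) * x2 ^ 2
      + (1 - n3 ^ 2) * x3 ^ 2 + 2 * (n1 + n2 * n3) * (x2 * x3) + 2 * (n2 + n3 * n1) * (x3 * x1)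
      + 2 * (n3 + n1 * n2) * (x1 * x2)
      + lam * (n1 ^ 2 + n2 ^ 2 + n3 ^ 2 + 2 * (n1 * n2 * n3) - 1) := by
    unfold areaSq height gramDet; ring
  rw [hG]
  have p1 := hx1.pos
  have p2 := hx2.pos
  have p3 := hx3.pos
  rcases hl with rfl | rfl
  · have k1 := mul_nonneg (show 0 ≤ 1 - n1 ^ 2 by linarith) (sq_nonneg x1)
    have k2 := mul_nonneg (show 0 ≤ 1 - n2 ^ 2 by linarith) (sq_nonneg x2)
    have k3 := mul_nonneg (show 0 ≤ 1 - n3 ^ 2 by linarith) (sq_nonneg x3)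
    have j1 := mul_nonneg (show 0 ≤ n1 + n2 * n3 by linarith) (mul_pos p2 p3).le
    have j2 := mul_nonneg (show 0 ≤ n2 + n3 * n1 by linarith) (mul_pos p3 p1).le
    have j3 := mul_nonneg (show 0 ≤ n3 + n1 * n2 by linarith) (mul_pos p1 p2).le
    by_contra! hc
    have z1 : (1 - n1 ^ 2) * x1 ^ 2 = 0 := by linarith
    have z2 : (1 - n2 ^ 2) * x2 ^ 2 = 0 := by linarith
    have z3 : (n3 + n1 * n2) * (x1 * x2) = 0 := by linarith
    have z4 : (1 - n3 ^ 2) * x3 ^ 2 = 0 := by linarith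
    rw [mul_eq_zero_iff_right (by positivity)] at z1 z2 z3 z4
    have y1 : n1 = 1 := by nlinarith
    have y2 : n2 = 1 := by nlinarith
    have y3 : n3 = 1 := by nlinarith
    subst y1 y2 y3
    norm_num at z3
  -- All coordinates exceed `1`, so the area is at least its value at `x = (1, 1, 1)`, which is `2 *
  -- (1 + n1) * (1 + n2) * (1 + n3)`.
  · have a1 := one_lt_of_inRange hx1
    have a2 := one_lt_of_inRange hx2
    have a3 := one_lt_of_inRange hx3
    have k1 := mul_nonneg (show 0 ≤ 1 - n1 ^ 2 by linarith) (show 0 ≤ x1 ^ 2 - 1 by nlinarith)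
    have k2 := mul_nonneg (show 0 ≤ 1 - n2 ^ 2 by linarith) (show 0 ≤ x2 ^ 2 - 1 by nlinarith)
    have k3 := mul_nonneg (show 0 ≤ 1 - n3 ^ 2 by linarith) (show 0 ≤ x3 ^ 2 - 1 by nlinarith)
    have j1 := mul_nonneg (show 0 ≤ n1 + n2 * n3 by linarith) (show 0 ≤ x2 * x3 - 1 by nlinarith)
    have j2 := mul_nonneg (show 0 ≤ n2 + n3 * n1 by linarith) (show 0 ≤ x3 * x1 - 1 by nlinarith)
    have j3 := mul_nonneg (show 0 ≤ n3 + n1 * n2 by linarith) (show 0 ≤ x1 * x2 - 1 by nlinarith)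
    have := mul_pos (mul_pos d1 d2) d3
    linarith

theorem areaSq_pos_of_height_pos (hl : lam = 0 ∨ lam = 1) (h : Admissible e1 e2 e3 n1 n2 n3)
    (hx1 : 0 < x1) (hx2 : 0 < x2) (hx3 : 0 < x3) (hA : 0 < n1 ^ 2 - e2 * e3)
    (hH1 : 0 < height e2 e3 n1 n2 n3 x1 x2 x3) (hH2 : 0 ≤ height e3 e1 n2 n3 n1 x2 x3 x1)
    (hH3 : 0 ≤ height e1 e2 n3 n1 n2 x3 x1 x2) :
    0 < areaSq lam e1 e2 e3 n1 n2 n3 x1 x2 x3 := by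
  have hG := h.gramDet_nonneg_of_coeff_pos hA
  have := weight_nonneg hl
  unfold areaSq
  positivity

/-- Otherwise all heights are nonnegative, and the expression of the area by the heights makes it
positive, unless no coefficient is positive; that case is `areaSq_pos_of_coeff_nonpos`. -/
theorem exists_height_nonpos (hl : lam = 0 ∨ lam = 1) (h : Admissible e1 e2 e3 n1 n2 n3)
    (hx1 : InRange lam e1 x1) (hx2 : InRange lam e2 x2) (hx3 : InRange lam e3 x3)
    (hQ : areaSq lam e1 e2 e3 n1 n2 n3 x1 x2 x3 ≤ 0) :
    (0 < n1 ^ 2 - e2 * e3 ∧ height e2 e3 n1 n2 n3 x1 x2 x3 ≤ 0) ∨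
      (0 < n2 ^ 2 - e3 * e1 ∧ height e3 e1 n2 n3 n1 x2 x3 x1 ≤ 0) ∨
      (0 < n3 ^ 2 - e1 * e2 ∧ height e1 e2 n3 n1 n2 x3 x1 x2 ≤ 0) := by
  by_contra! hc
  obtain ⟨c1, c2, c3⟩ := hc
  have hH1 : 0 ≤ height e2 e3 n1 n2 n3 x1 x2 x3 :=
    (le_or_gt _ _).elim (fun r => h.height_nonneg_of_coeff_nonpos r hx1.pos hx2.pos hx3.pos)
      fun r => (c1 r).le
  have hH2 : 0 ≤ height e3 e1 n2 n3 n1 x2 x3 x1 :=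
    (le_or_gt _ _).elim
      (fun r => h.rotate.height_nonneg_of_coeff_nonpos r hx2.pos hx3.pos hx1.pos)
      fun r => (c2 r).le
  have hH3 : 0 ≤ height e1 e2 n3 n1 n2 x3 x1 x2 :=
    (le_or_gt _ _).elim
      (fun r => h.rotate.rotate.height_nonneg_of_coeff_nonpos r hx3.pos hx1.pos hx2.pos)
      fun r => (c3 r).le
  have hQ2 := hQ
  rw [areaSq_rotate] at hQ2
  have hQ3 := hQ2
  rw [areaSq_rotate] at hQ3
  rcases le_or_gt (n1 ^ 2 - e2 * e3) 0 with a1 | a1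
  · rcases le_or_gt (n2 ^ 2 - e3 * e1) 0 with a2 | a2
    · rcases le_or_gt (n3 ^ 2 - e1 * e2) 0 with a3 | a3
      · exact hQ.not_gt (areaSq_pos_of_coeff_nonpos hl h hx1 hx2 hx3 a1 a2 a3)
      · exact hQ3.not_gt (areaSq_pos_of_height_pos hl h.rotate.rotate hx3.pos hx1.pos hx2.pos a3
          (c3 a3) hH1 hH2)
    · exact hQ2.not_gt (areaSq_pos_of_height_pos hl h.rotate hx2.pos hx3.pos hx1.pos a2
        (c2 a2) hH3 hH1)
  · exact hQ.not_gt (areaSq_pos_of_height_pos hl h hx1.pos hx2.pos hx3.pos a1 (c1 a1) hH2 hH3)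

/-- In a degenerate triangle the angle at the corner `1` is flat if and only if the power center
lies beyond the opposite side. -/
theorem cosNum_neg_iff (hl : lam = 0 ∨ lam = 1) (h : Admissible e1 e2 e3 n1 n2 n3)
    (hx1 : InRange lam e1 x1) (hx2 : InRange lam e2 x2) (hx3 : InRange lam e3 x3)
    (hQ : areaSq lam e1 e2 e3 n1 n2 n3 x1 x2 x3 ≤ 0) :
    cosNum lam e1 n1 n2 n3 x1 x2 x3 < 0 ↔
      0 < n1 ^ 2 - e2 * e3 ∧ height e2 e3 n1 n2 n3 x1 x2 x3 ≤ 0 := by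
  have hQ2 := hQ
  rw [areaSq_rotate] at hQ2
  have hQ3 := hQ2
  rw [areaSq_rotate] at hQ3
  refine ⟨fun hP => ?_, fun ⟨a, b⟩ => cosNum_neg_of_height_nonpos hl h hx1 hx2 hx3 hQ a b⟩
  rcases exists_height_nonpos hl h hx1 hx2 hx3 hQ with r | ⟨r, r'⟩ | ⟨r, r'⟩
  · exact r
  · have := cosNum_neg_of_height_nonpos hl h.rotate hx2 hx3 hx1 hQ2 r r'
    exact absurd hP (cosNum_pos_of_nonpos hl h.rotate hx2 hx3 hx1 this.le).not_gt
  · have := cosNum_neg_of_height_nonpos hl h.rotate.rotate hx3 hx1 hx2 hQ3 r r'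
    exact absurd this (cosNum_pos_of_nonpos hl h hx1 hx2 hx3 hP.le).not_gt

/-- The angle at the corner `1`; it is `0` or `π` in degenerate triangles. -/
def cornerAngle (lam e1 e2 e3 n1 n2 n3 x1 x2 x3 : ℝ) : ℝ :=
  Real.arccos (cosNum lam e1 n1 n2 n3 x1 x2 x3 /
    (√(sideSq lam e3 e1 n2 x3 x1) * √(sideSq lam e1 e2 n3 x1 x2)))

/-- Nonpositive area puts the argument of `Real.arccos` outside `(-1, 1)`, where the function is
clamped; the sign of `cosNum` decides between `π` and `0`. -/
theorem cornerAngle_of_degenerate (hl : lam = 0 ∨ lam = 1) (h : Admissible e1 e2 e3 n1 n2 n3)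
    (hx1 : InRange lam e1 x1) (hx2 : InRange lam e2 x2) (hx3 : InRange lam e3 x3)
    (hQ : areaSq lam e1 e2 e3 n1 n2 n3 x1 x2 x3 ≤ 0) :
    (0 < n1 ^ 2 - e2 * e3 ∧ height e2 e3 n1 n2 n3 x1 x2 x3 ≤ 0 ∧
        cornerAngle lam e1 e2 e3 n1 n2 n3 x1 x2 x3 = Real.pi) ∨
      (¬(0 < n1 ^ 2 - e2 * e3 ∧ height e2 e3 n1 n2 n3 x1 x2 x3 ≤ 0) ∧
        cornerAngle lam e1 e2 e3 n1 n2 n3 x1 x2 x3 = 0) := by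
  have hN2 := sideSq_pos hl h.weight3 h.weight1 h.edge2 hx3 hx1
  have hN3 := sideSq_pos hl h.weight1 h.weight2 h.edge3 hx1 hx2
  have hid := sideSq_mul_sideSq_sub_cosNum_sq lam e1 e2 e3 n1 n2 n3 x1 x2 x3
  have hle : (√(sideSq lam e3 e1 n2 x3 x1) * √(sideSq lam e1 e2 n3 x1 x2)) ^ 2 ≤
      cosNum lam e1 n1 n2 n3 x1 x2 x3 ^ 2 := by
    rw [mul_pow, Real.sq_sqrt hN2.le, Real.sq_sqrt hN3.le]
    have := mul_nonneg hx1.sq_sub_pos.le (neg_nonneg.2 hQ)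
    linarith
  have hpos := mul_pos (Real.sqrt_pos.2 hN2) (Real.sqrt_pos.2 hN3)
  rw [← and_assoc, ← cosNum_neg_iff hl h hx1 hx2 hx3 hQ]
  unfold cornerAngle
  by_cases hP : cosNum lam e1 n1 n2 n3 x1 x2 x3 < 0
  · refine Or.inl ⟨hP, ?_⟩
    rw [Real.arccos_eq_pi, div_le_iff₀ hpos]
    have := sq_le_sq.1 hle
    rw [abs_of_pos hpos, abs_of_neg hP] at this
    linarith
  · refine Or.inr ⟨hP, ?_⟩
    rw [Real.arccos_eq_zero, le_div_iff₀ hpos]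
    have := sq_le_sq.1 hle
    rw [abs_of_pos hpos, abs_of_nonneg (not_lt.1 hP)] at this
    linarith

theorem areaSq_pos_iff (hl : lam = 0 ∨ lam = 1) (h : Admissible e1 e2 e3 n1 n2 n3)
    (hx1 : InRange lam e1 x1) (hx2 : InRange lam e2 x2) (hx3 : InRange lam e3 x3) :
    0 < areaSq lam e1 e2 e3 n1 n2 n3 x1 x2 x3 ↔
      |cosNum lam e1 n1 n2 n3 x1 x2 x3| <
        √(sideSq lam e3 e1 n2 x3 x1) * √(sideSq lam e1 e2 n3 x1 x2) := by
  have hN2 := sideSq_pos hl h.weight3 h.weight1 h.edge2 hx3 hx1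
  have hN3 := sideSq_pos hl h.weight1 h.weight2 h.edge3 hx1 hx2
  have hid := sideSq_mul_sideSq_sub_cosNum_sq lam e1 e2 e3 n1 n2 n3 x1 x2 x3
  have hpos := mul_pos (Real.sqrt_pos.2 hN2) (Real.sqrt_pos.2 hN3)
  rw [← abs_of_pos hpos, ← sq_lt_sq, mul_pow, Real.sq_sqrt hN2.le, Real.sq_sqrt hN3.le,
    ← sub_pos (a := _ * _), hid, mul_pos_iff_of_pos_left hx1.sq_sub_pos]

end DiscreteConformal

/-! ### Monotone functions with finitely many exceptional values, and the derivative of an angle. -/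

namespace DiscreteConformal

open Set

/-- A continuous function that is differentiable with nonnegative derivative wherever its value is
outside of a finite set is monotone. -/
theorem monotoneOn_of_hasDerivAt_nonneg_or_mem_finite {g : ℝ → ℝ} {S : Set ℝ} {a b : ℝ}
    (hS : S.Finite) (hc : ContinuousOn g (Icc a b))
    (h : ∀ t ∈ Icc a b, g t ∈ S ∨ ∃ g', 0 ≤ g' ∧ HasDerivAt g g' t) : MonotoneOn g (Icc a b) := by
  intro s hs t ht hst
  by_contra! hlt
  -- If the value drops from `g s` to `g t`, it crosses a whole band of values around some `c` that
  -- avoids `S`.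
  obtain ⟨c, hcI, hcS⟩ := ((Ioo_infinite hlt).sdiff hS).nonempty
  have hopen : IsOpen (Ioo (g t) (g s) \ S) := isOpen_Ioo.sdiff hS.isClosed
  obtain ⟨δ, hδ, hball⟩ := Metric.isOpen_iff.1 hopen c ⟨hcI, hcS⟩
  have hmem : ∀ y, c - δ / 2 ≤ y → y ≤ c + δ / 2 → y ∈ Ioo (g t) (g s) \ S := fun y h1 h2 =>
    hball (by rw [Metric.mem_ball, Real.dist_eq, abs_lt]; constructor <;> linarith)
  have hsub : Icc s t ⊆ Icc a b := Icc_subset_Icc hs.1 ht.2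
  have hK1 : IsCompact (Icc s t ∩ g ⁻¹' Ici (c + δ / 2)) :=
    isCompact_Icc.of_isClosed_subset
      ((hc.mono hsub).preimage_isClosed_of_isClosed isClosed_Icc isClosed_Ici) inter_subset_left
  -- The last time above the band and then the first time below it: strictly between them the values
  -- stay in the band, where the derivative is nonnegative, so no drop is possible.
  obtain ⟨s', ⟨hs'1, hs'2⟩, hs'max⟩ := hK1.exists_isGreatest
    ⟨s, left_mem_Icc.2 hst, (hmem (c + δ / 2) (by linarith) le_rfl).1.2.le⟩
  have hsub' : Icc s' t ⊆ Icc a b := (Icc_subset_Icc_left hs'1.1).trans hsub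
  have hK2 : IsCompact (Icc s' t ∩ g ⁻¹' Iic (c - δ / 2)) :=
    isCompact_Icc.of_isClosed_subset
      ((hc.mono hsub').preimage_isClosed_of_isClosed isClosed_Icc isClosed_Iic) inter_subset_left
  obtain ⟨t', ⟨ht'1, ht'2⟩, ht'min⟩ := hK2.exists_isLeast
    ⟨t, right_mem_Icc.2 hs'1.2, (hmem (c - δ / 2) le_rfl (by linarith)).1.1.le⟩
  simp only [mem_preimage, mem_Ici, mem_Iic] at hs'2 ht'2
  have key : ∀ x ∈ Ioo s' t', ∃ g', 0 ≤ g' ∧ HasDerivAt g g' x := by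
    intro x hx
    have hxI : x ∈ Icc s' t := ⟨hx.1.le, hx.2.le.trans ht'1.2⟩
    refine (h x (hsub' hxI)).resolve_left (hmem _ ?_ ?_).2
    · by_contra! hh
      exact (ht'min ⟨hxI, hh.le⟩).not_gt hx.2
    · by_contra! hh
      exact (hs'max ⟨⟨hs'1.1.trans hxI.1, hxI.2⟩, hh.le⟩).not_gt hx.1
  have hmono : MonotoneOn g (Icc s' t') := by
    refine monotoneOn_of_deriv_nonneg (convex_Icc _ _)
      (hc.mono ((Icc_subset_Icc_right ht'1.2).trans hsub')) ?_ ?_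
    · rw [interior_Icc]
      intro x hx
      obtain ⟨g', -, hg⟩ := key x hx
      exact hg.differentiableAt.differentiableWithinAt
    · rw [interior_Icc]
      intro x hx
      obtain ⟨g', h0, hg⟩ := key x hx
      rwa [hg.deriv]
  have := hmono (left_mem_Icc.2 ht'1.1) (right_mem_Icc.2 ht'1.1) ht'1.1
  linarith

theorem lt_of_monotoneOn_of_hasDerivAt_pos {g : ℝ → ℝ} {g' a b : ℝ} (hab : a < b)
    (hm : MonotoneOn g (Icc a b)) (hg : HasDerivAt g g' a) (hpos : 0 < g') : g a < g b := by
  have h1 := (hasDerivAt_iff_tendsto_slope.1 hg).eventually (lt_mem_nhds hpos)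
  have h2 : ∀ᶠ x in nhdsWithin a (Ioi a), 0 < slope g a x :=
    h1.filter_mono (nhdsWithin_mono _ fun x hx => ne_of_gt hx)
  have h3 : ∀ᶠ x in nhdsWithin a (Ioi a), x ∈ Ioo a b := Ioo_mem_nhdsGT hab
  obtain ⟨x, hx1, hx2⟩ := (h2.and h3).exists
  rw [slope_def_field] at hx1
  have := (div_pos_iff_of_pos_right (sub_pos.2 hx2.1)).1 hx1
  have := hm ⟨hx2.1.le, hx2.2.le⟩ (right_mem_Icc.2 hab.le) hx2.2.le
  linarith

theorem hasDerivAt_arccos_div_sqrt {P M N : ℝ → ℝ} {P' M' N' d t : ℝ} (hP : HasDerivAt P P' t)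
    (hM : HasDerivAt M M' t) (hN : HasDerivAt N N' t) (hM0 : 0 < M t) (hN0 : 0 < N t) (hd : 0 < d)
    (heq : M t * N t - P t ^ 2 = d ^ 2) :
    HasDerivAt (fun t => Real.arccos (P t / (√(M t) * √(N t))))
      (-(P' - P t * (M' / (2 * M t) + N' / (2 * N t))) / d) t := by
  have hm := Real.sqrt_pos.2 hM0
  have hn := Real.sqrt_pos.2 hN0
  have hX := hP.div ((hM.sqrt hM0.ne').mul (hN.sqrt hN0.ne')) (mul_pos hm hn).ne'
  have e1 : M t = √(M t) ^ 2 := (Real.sq_sqrt hM0.le).symm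
  have e2 : N t = √(N t) ^ 2 := (Real.sq_sqrt hN0.le).symm
  have hone : 1 - (P t / (√(M t) * √(N t))) ^ 2 = (d / (√(M t) * √(N t))) ^ 2 := by
    rw [div_pow, div_pow, ← heq]
    rw [mul_pow, ← e1, ← e2]
    field_simp
  have hpos : 0 < d / (√(M t) * √(N t)) := by positivity
  have hne1 : P t / (√(M t) * √(N t)) ≠ -1 := fun hh => by
    rw [hh] at hone
    nlinarith
  have hne2 : P t / (√(M t) * √(N t)) ≠ 1 := fun hh => by
    rw [hh] at hone
    nlinarith
  have := (Real.hasDerivAt_arccos hne1 hne2).comp t hX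
  refine this.congr_deriv ?_
  simp only [Pi.mul_apply]
  rw [hone, Real.sqrt_sq hpos.le]
  generalize √(M t) = m at *
  generalize √(N t) = n at *
  rw [e1, e2]
  field_simp

variable {lam e1 e2 e3 n1 n2 n3 w1 w2 w3 : ℝ}

/-- The normalization `x' = w * s` is chosen so that the coefficient of `w2` is symmetric in the
vertices 1 and 2, and likewise for 3. The sine of the angle contributes `s1` times the root of the
area, and the `s1` cancels. -/
theorem hasDerivAt_cornerAngle {x1 x2 x3 : ℝ → ℝ} {s1 s2 s3 t : ℝ} (hl : lam = 0 ∨ lam = 1)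
    (h : Admissible e1 e2 e3 n1 n2 n3)
    (hx1 : InRange lam e1 (x1 t)) (hx2 : InRange lam e2 (x2 t)) (hx3 : InRange lam e3 (x3 t))
    (hs1 : 0 < s1) (hs1' : s1 ^ 2 = x1 t ^ 2 - lam * e1)
    (hd1 : HasDerivAt x1 (w1 * s1) t) (hd2 : HasDerivAt x2 (w2 * s2) t)
    (hd3 : HasDerivAt x3 (w3 * s3) t)
    (hQ : 0 < areaSq lam e1 e2 e3 n1 n2 n3 (x1 t) (x2 t) (x3 t)) :
    HasDerivAt (fun t => cornerAngle lam e1 e2 e3 n1 n2 n3 (x1 t) (x2 t) (x3 t))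
      ((height e1 e2 n3 n1 n2 (x3 t) (x1 t) (x2 t) / sideSq lam e1 e2 n3 (x1 t) (x2 t) *
            ((x1 t * x2 t + lam * n3) * w1 - s1 * s2 * w2)
          + height e3 e1 n2 n3 n1 (x2 t) (x3 t) (x1 t) / sideSq lam e3 e1 n2 (x3 t) (x1 t) *
            ((x3 t * x1 t + lam * n2) * w1 - s3 * s1 * w3)) /
        √(areaSq lam e1 e2 e3 n1 n2 n3 (x1 t) (x2 t) (x3 t))) t := by
  have hN2 := sideSq_pos hl h.weight3 h.weight1 h.edge2 hx3 hx1
  have hN3 := sideSq_pos hl h.weight1 h.weight2 h.edge3 hx1 hx2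
  have hside : ∀ {y z : ℝ → ℝ} {y' z' : ℝ} (a b n : ℝ), HasDerivAt y y' t → HasDerivAt z z' t →
      HasDerivAt (fun t => sideSq lam a b n (y t) (z t))
        (2 * ((a * z t + n * y t) * z' + (b * y t + n * z t) * y')) t := by
    intro y z y' z' a b n hy hz
    have := ((((hz.pow 2).const_mul a).add ((hy.pow 2).const_mul b)).add
      ((hy.const_mul (2 * n)).mul hz)).add_const (lam * (n ^ 2 - a * b))
    refine this.congr_deriv ?_
    simp
    ring
  have hcos : HasDerivAt (fun t => cosNum lam e1 n1 n2 n3 (x1 t) (x2 t) (x3 t))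
      ((e1 * x3 t + n2 * x1 t) * (w2 * s2) + (e1 * x2 t + n3 * x1 t) * (w3 * s3)
        + (x2 t * n2 + x3 t * n3 - 2 * x1 t * n1) * (w1 * s1)) t := by
    have := ((((hd2.const_mul e1).mul hd3).const_add (lam * (e1 * n1 + n2 * n3))).add
      (hd1.mul ((hd2.mul_const n2).add (hd3.mul_const n3)))).sub ((hd1.pow 2).mul_const n1)
    refine (this.congr_deriv ?_).congr_of_eventuallyEq (Filter.Eventually.of_forall fun t => ?_)
    · simp; ring
    · simp [cosNum]
  have hq := Real.sqrt_pos.2 hQ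
  have := hasDerivAt_arccos_div_sqrt hcos (hside e3 e1 n2 hd3 hd1) (hside e1 e2 n3 hd1 hd2) hN2 hN3
    (mul_pos hs1 hq) (by
      rw [sideSq_mul_sideSq_sub_cosNum_sq, mul_pow, hs1', Real.sq_sqrt hQ.le])
  refine this.congr_deriv ?_
  have o1 := sideSq_mul_sub_cosNum_mul lam e1 e2 n1 n2 n3 (x1 t) (x2 t) (x3 t)
  have o2 := sideSq_mul_sub_cosNum_mul lam e1 e3 n1 n3 n2 (x1 t) (x3 t) (x2 t)
  rw [sideSq_swap lam e1 e3, cosNum_swap, height_swap e1 e3] at o2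
  have m1 := height_mul_sub_cosNum_mul lam e2 e1 n2 n1 n3 (x2 t) (x1 t) (x3 t)
  rw [sideSq_swap lam e2 e1, cosNum_swap, height_swap e2 e1] at m1
  have m2 := height_mul_sub_cosNum_mul lam e3 e1 n3 n1 n2 (x3 t) (x1 t) (x2 t)
  rw [← hs1'] at o1 o2
  generalize areaSq lam e1 e2 e3 n1 n2 n3 (x1 t) (x2 t) (x3 t) = Q at *
  generalize sideSq lam e3 e1 n2 (x3 t) (x1 t) = N2 at *
  generalize sideSq lam e1 e2 n3 (x1 t) (x2 t) = N3 at *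
  generalize cosNum lam e1 n1 n2 n3 (x1 t) (x2 t) (x3 t) = P at *
  generalize height e1 e2 n3 n1 n2 (x3 t) (x1 t) (x2 t) = H3 at *
  generalize height e3 e1 n2 n3 n1 (x2 t) (x3 t) (x1 t) = H2 at *
  field_simp
  linear_combination (-N2 * w2 * s2) * o1 - N3 * w3 * s3 * o2 - N2 * w1 * s1 * m1
    - N3 * w1 * s1 * m2

end DiscreteConformal

/-! ### Paths of structures and the monotonicity of the angles of a triangle along them. -/

namespace DiscreteConformal

open Set

variable {lam e e1 e2 e3 n1 n2 n3 w w1 w2 w3 : ℝ} {x s x1 x2 x3 s1 s2 s3 : ℝ → ℝ}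

/-- A path `x` of coordinates at a vertex of weight `e`, along which the logarithmic coordinate has
constant velocity `w`. -/
structure IsPath (lam e w : ℝ) (x s : ℝ → ℝ) : Prop where
  inRange : ∀ t ∈ Icc (0 : ℝ) 1, InRange lam e (x t)
  pos : ∀ t ∈ Icc (0 : ℝ) 1, 0 < s t
  sq_eq : ∀ t ∈ Icc (0 : ℝ) 1, s t ^ 2 = x t ^ 2 - lam * e
  hasDerivAt : ∀ t ∈ Icc (0 : ℝ) 1, HasDerivAt x (w * s t) t

/-- Continuity holds through degenerations too: the sides never vanish and the clamped `Real.arccos`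
is continuous on the whole line. -/
theorem continuousAt_cornerAngle {t : ℝ} (hl : lam = 0 ∨ lam = 1)
    (h : Admissible e1 e2 e3 n1 n2 n3) (ht : t ∈ Icc (0 : ℝ) 1)
    (hx1 : IsPath lam e1 w1 x1 s1) (hx2 : IsPath lam e2 w2 x2 s2) (hx3 : IsPath lam e3 w3 x3 s3) :
    ContinuousAt (fun t => cornerAngle lam e1 e2 e3 n1 n2 n3 (x1 t) (x2 t) (x3 t)) t := by
  have c1 := (hx1.hasDerivAt t ht).continuousAt
  have c2 := (hx2.hasDerivAt t ht).continuousAt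
  have c3 := (hx3.hasDerivAt t ht).continuousAt
  have hN2 := sideSq_pos hl h.weight3 h.weight1 h.edge2 (hx3.inRange t ht) (hx1.inRange t ht)
  have hN3 := sideSq_pos hl h.weight1 h.weight2 h.edge3 (hx1.inRange t ht) (hx2.inRange t ht)
  unfold cornerAngle
  refine Real.continuous_arccos.continuousAt.comp (ContinuousAt.div ?_ (ContinuousAt.mul ?_ ?_)
    (mul_pos (Real.sqrt_pos.2 hN2) (Real.sqrt_pos.2 hN3)).ne')
  · unfold cosNum; fun_prop
  · unfold sideSq; fun_prop
  · unfold sideSq; fun_prop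

theorem cornerAngle_mem_of_degenerate {y1 y2 y3 : ℝ} (hl : lam = 0 ∨ lam = 1)
    (h : Admissible e1 e2 e3 n1 n2 n3)
    (hx1 : InRange lam e1 y1) (hx2 : InRange lam e2 y2) (hx3 : InRange lam e3 y3)
    (hQ : areaSq lam e1 e2 e3 n1 n2 n3 y1 y2 y3 ≤ 0) :
    cornerAngle lam e1 e2 e3 n1 n2 n3 y1 y2 y3 ∈ ({Real.pi, 0} : Set ℝ) := by
  rcases cornerAngle_of_degenerate hl h hx1 hx2 hx3 hQ with r | r
  · exact Or.inl r.2.2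
  · exact Or.inr r.2

/-- The angles of a triangle, paired with the velocity of a path. -/
def angleWork (lam e1 e2 e3 n1 n2 n3 w1 w2 w3 y1 y2 y3 : ℝ) : ℝ :=
  cornerAngle lam e1 e2 e3 n1 n2 n3 y1 y2 y3 * w1 + cornerAngle lam e2 e3 e1 n2 n3 n1 y2 y3 y1 * w2
    + cornerAngle lam e3 e1 e2 n3 n1 n2 y3 y1 y2 * w3

theorem hasDerivAt_angleWork {t : ℝ} (hl : lam = 0 ∨ lam = 1)
    (h : Admissible e1 e2 e3 n1 n2 n3) (ht : t ∈ Icc (0 : ℝ) 1)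
    (hx1 : IsPath lam e1 w1 x1 s1) (hx2 : IsPath lam e2 w2 x2 s2) (hx3 : IsPath lam e3 w3 x3 s3)
    (hQ : 0 < areaSq lam e1 e2 e3 n1 n2 n3 (x1 t) (x2 t) (x3 t)) :
    HasDerivAt (fun t => angleWork lam e1 e2 e3 n1 n2 n3 w1 w2 w3 (x1 t) (x2 t) (x3 t))
      (angleForm lam e1 e2 e3 n1 n2 n3 (x1 t) (x2 t) (x3 t) (s1 t) (s2 t) (s3 t) w1 w2 w3 /
        √(areaSq lam e1 e2 e3 n1 n2 n3 (x1 t) (x2 t) (x3 t))) t := by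
  have hQ2 := hQ
  rw [areaSq_rotate] at hQ2
  have hQ3 := hQ2
  rw [areaSq_rotate] at hQ3
  have d1 := hasDerivAt_cornerAngle hl h (hx1.inRange t ht) (hx2.inRange t ht) (hx3.inRange t ht)
    (hx1.pos t ht) (hx1.sq_eq t ht) (hx1.hasDerivAt t ht) (hx2.hasDerivAt t ht)
    (hx3.hasDerivAt t ht) hQ
  have d2 := hasDerivAt_cornerAngle hl h.rotate (hx2.inRange t ht) (hx3.inRange t ht)
    (hx1.inRange t ht) (hx2.pos t ht) (hx2.sq_eq t ht) (hx2.hasDerivAt t ht)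
    (hx3.hasDerivAt t ht) (hx1.hasDerivAt t ht) hQ2
  have d3 := hasDerivAt_cornerAngle hl h.rotate.rotate (hx3.inRange t ht) (hx1.inRange t ht)
    (hx2.inRange t ht) (hx3.pos t ht) (hx3.sq_eq t ht) (hx3.hasDerivAt t ht)
    (hx1.hasDerivAt t ht) (hx2.hasDerivAt t ht) hQ3
  rw [← areaSq_rotate] at d2
  rw [← areaSq_rotate, ← areaSq_rotate] at d3
  refine (((d1.mul_const w1).add (d2.mul_const w2)).add (d3.mul_const w3)).congr_deriv ?_
  unfold angleForm
  ring

/-- Strict monotonicity of the angles of a triangle along paths that start at a nondegenerate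
triangle. -/
theorem angleWork_monotone (hl : lam = 0 ∨ lam = 1) (h : Admissible e1 e2 e3 n1 n2 n3)
    (hx1 : IsPath lam e1 w1 x1 s1) (hx2 : IsPath lam e2 w2 x2 s2) (hx3 : IsPath lam e3 w3 x3 s3)
    (hQ : 0 < areaSq lam e1 e2 e3 n1 n2 n3 (x1 0) (x2 0) (x3 0)) :
    angleWork lam e1 e2 e3 n1 n2 n3 w1 w2 w3 (x1 0) (x2 0) (x3 0) ≤
        angleWork lam e1 e2 e3 n1 n2 n3 w1 w2 w3 (x1 1) (x2 1) (x3 1) ∧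
      (angleWork lam e1 e2 e3 n1 n2 n3 w1 w2 w3 (x1 0) (x2 0) (x3 0) =
          angleWork lam e1 e2 e3 n1 n2 n3 w1 w2 w3 (x1 1) (x2 1) (x3 1) →
        w1 = w2 ∧ w2 = w3 ∧ (lam = 1 → w1 = 0)) := by
  have hform : ∀ t ∈ Icc (0 : ℝ) 1, 0 < areaSq lam e1 e2 e3 n1 n2 n3 (x1 t) (x2 t) (x3 t) →
      FormDefinite lam e1 e2 e3 n1 n2 n3 (x1 t) (x2 t) (x3 t) (s1 t) (s2 t) (s3 t) w1 w2 w3 :=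
    fun t ht hQ => formDefinite hl h (hx1.inRange t ht) (hx2.inRange t ht) (hx3.inRange t ht)
      (hx1.pos t ht) (hx2.pos t ht) (hx3.pos t ht) (hx1.sq_eq t ht) (hx2.sq_eq t ht)
      (hx3.sq_eq t ht) hQ
  have h0 : (0 : ℝ) ∈ Icc (0 : ℝ) 1 := left_mem_Icc.2 zero_le_one
  have h1 : (1 : ℝ) ∈ Icc (0 : ℝ) 1 := right_mem_Icc.2 zero_le_one
  -- The exceptional values: in a degenerate triangle each angle is `0` or `π`.
  have hfin : ((fun p : ℝ × ℝ × ℝ => p.1 * w1 + p.2.1 * w2 + p.2.2 * w3) ''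
      (({Real.pi, 0} : Set ℝ) ×ˢ ({Real.pi, 0} : Set ℝ) ×ˢ ({Real.pi, 0} : Set ℝ))).Finite :=
    ((toFinite _).prod ((toFinite _).prod (toFinite _))).image _
  have hmono := monotoneOn_of_hasDerivAt_nonneg_or_mem_finite
    (g := fun t => angleWork lam e1 e2 e3 n1 n2 n3 w1 w2 w3 (x1 t) (x2 t) (x3 t)) (a := 0) (b := 1)
    hfin (fun t ht => by
      have c1 := continuousAt_cornerAngle hl h ht hx1 hx2 hx3
      have c2 := continuousAt_cornerAngle hl h.rotate ht hx2 hx3 hx1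
      have c3 := continuousAt_cornerAngle hl h.rotate.rotate ht hx3 hx1 hx2
      exact (((c1.mul_const w1).add (c2.mul_const w2)).add (c3.mul_const w3)).continuousWithinAt)
    (fun t ht => by
      rcases le_or_gt (areaSq lam e1 e2 e3 n1 n2 n3 (x1 t) (x2 t) (x3 t)) 0 with hq | hq
      · have hq2 := hq
        rw [areaSq_rotate] at hq2
        have hq3 := hq2
        rw [areaSq_rotate] at hq3
        have r1 := hx1.inRange t ht
        have r2 := hx2.inRange t ht
        have r3 := hx3.inRange t ht
        exact Or.inl ⟨(_, _, _), ⟨cornerAngle_mem_of_degenerate hl h r1 r2 r3 hq,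
          cornerAngle_mem_of_degenerate hl h.rotate r2 r3 r1 hq2,
          cornerAngle_mem_of_degenerate hl h.rotate.rotate r3 r1 r2 hq3⟩, rfl⟩
      · refine Or.inr ⟨_, div_nonneg ?_ (Real.sqrt_nonneg _),
          hasDerivAt_angleWork hl h ht hx1 hx2 hx3 hq⟩
        rcases hform t ht hq with r | r
        · exact r.le
        · exact r.1.ge)
  refine ⟨hmono h0 h1 zero_le_one, fun heq => ?_⟩
  rcases hform 0 h0 hQ with r | r
  · have := lt_of_monotoneOn_of_hasDerivAt_pos one_pos hmono
      (hasDerivAt_angleWork hl h h0 hx1 hx2 hx3 hQ) (div_pos r (Real.sqrt_pos.2 hQ))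
    exact absurd heq this.ne
  · exact r.2

/-! ### Coordinates -/

/-- The coordinate `κ` of a vertex, as a function of `f`. -/
def coord (lam e f : ℝ) : ℝ := √(1 + lam * e * Real.exp (2 * f)) / Real.exp f

/-- The logarithmic coordinate of a vertex, whose velocity is that of a path. -/
def logCoord (lam e f : ℝ) : ℝ :=
  if lam = 1 ∧ e = 1 then Real.arsinh (Real.exp (-f)) else -f

theorem logCoord_injective : Function.Injective (logCoord lam e) := by
  intro f g hfg
  unfold logCoord at hfg
  split_ifs at hfg with hh
  · exact neg_injective (Real.exp_injective (Real.arsinh_injective hfg))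
  · exact neg_injective hfg

theorem logCoord_zero (f : ℝ) : logCoord 0 e f = -f := by simp [logCoord]

theorem coord_sq (he : e = 0 ∨ e = 1) (hl : lam = 0 ∨ lam = 1) (f : ℝ) :
    coord lam e f ^ 2 - lam * e = Real.exp (-f) ^ 2 := by
  have h1 := weight_nonneg he
  have h2 := weight_nonneg hl
  unfold coord
  rw [div_pow, Real.sq_sqrt (by positivity), Real.exp_neg, two_mul, Real.exp_add]
  field_simp
  ring

theorem inRange_coord (he : e = 0 ∨ e = 1) (hl : lam = 0 ∨ lam = 1) (f : ℝ) :
    InRange lam e (coord lam e f) := by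
  refine ⟨?_, by rw [coord_sq he hl]; positivity⟩
  have h1 := weight_nonneg he
  have h2 := weight_nonneg hl
  unfold coord
  positivity

/-- Any two values of the coordinate are joined by a path. -/
theorem exists_isPath (hl : lam = 0 ∨ lam = 1) (he : e = 0 ∨ e = 1) (f g : ℝ) :
    ∃ x s : ℝ → ℝ, IsPath lam e (logCoord lam e g - logCoord lam e f) x s ∧
      x 0 = coord lam e f ∧ x 1 = coord lam e g := by
  by_cases hh : lam = 1 ∧ e = 1
  · obtain ⟨rfl, rfl⟩ := hh
    -- With `u = logCoord`, `sinh u = e^{-f}` and `cosh u = κ`, so a straight line in `u` satisfies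
    -- `x' = w * s`.
    have hc : ∀ f, Real.cosh (logCoord 1 1 f) = coord 1 1 f := by
      intro f
      have hp := inRange_coord (Or.inr rfl) (Or.inr rfl) f (lam := 1) (e := 1)
      rw [← sq_eq_sq₀ (Real.cosh_pos _).le hp.pos.le, Real.cosh_sq]
      have := coord_sq (Or.inr rfl) (Or.inr rfl) f (lam := 1) (e := 1)
      simp only [logCoord, and_self, if_true, Real.sinh_arsinh]
      linarith
    have hpos : ∀ f, 0 < logCoord 1 1 f := fun f => by
      simp only [logCoord, and_self, if_true, Real.arsinh_pos_iff]
      positivity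
    set a := logCoord 1 1 f with ha
    set b := logCoord 1 1 g with hb
    have ha0 : 0 < a := hpos f
    have hb0 : 0 < b := hpos g
    have hline : ∀ t ∈ Icc (0 : ℝ) 1, 0 < Real.sinh (a + t * (b - a)) := fun t ht => by
      rw [Real.sinh_pos_iff]
      rcases ht.2.eq_or_lt with r | r
      · rw [r]; linarith
      · nlinarith [mul_pos (sub_pos.2 r) ha0, mul_nonneg ht.1 hb0.le]
    refine ⟨fun t => Real.cosh (a + t * (b - a)), fun t => Real.sinh (a + t * (b - a)),
      ⟨fun t ht => ⟨Real.cosh_pos _, ?_⟩, hline, fun t _ => ?_, fun t _ => ?_⟩, ?_, ?_⟩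
    · have := pow_pos (hline t ht) 2
      rw [Real.cosh_sq]
      linarith
    · rw [Real.cosh_sq]; ring
    · have hd := ((hasDerivAt_id t).mul_const (b - a)).const_add a
      refine (hd.cosh).congr_deriv ?_
      simp; ring
    · rw [← hc]; simp [ha]
    · rw [← hc]; simp [hb]
  · have hz : lam * e = 0 := by
      rcases hl with rfl | rfl
      · simp
      · rcases he with rfl | rfl
        · simp
        · simp at hh
    -- Here `κ` reduces to `e^{-f}`, so `x` and `s` coincide and are exponentials of a straight line
    -- in `-f`.
    have hc : ∀ f, Real.exp (-f) = coord lam e f := fun f => by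
      simp [coord, hz, Real.exp_neg]
    simp only [logCoord, hh, if_false]
    refine ⟨fun t => Real.exp (-f + t * (-g - -f)), fun t => Real.exp (-f + t * (-g - -f)),
      ⟨fun t _ => ⟨Real.exp_pos _, ?_⟩, fun t _ => Real.exp_pos _, fun t _ => ?_, fun t _ => ?_⟩,
      ?_, ?_⟩
    · rw [hz]; simp only [sub_zero]; positivity
    · rw [hz, sub_zero]
    · have hd := ((hasDerivAt_id t).mul_const (-g - -f)).const_add (-f)
      refine (hd.exp).congr_deriv ?_
      simp; ring
    · rw [← hc]; simp
    · rw [← hc]; simp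

end DiscreteConformal

/-! ### Cosine laws, triangle inequalities and the regions `V_i` in normalized form. -/

namespace DiscreteConformal

theorem abs_euclidean_cos_lt_one_iff {a b d : ℝ} (ha : 0 < a) (hb : 0 < b) (hd : 0 < d) :
    |(b ^ 2 + d ^ 2 - a ^ 2) / (2 * b * d)| < 1 ↔ a < b + d ∧ b < d + a ∧ d < a + b := by
  have hp : 0 < 2 * b * d := by positivity
  rw [abs_lt, lt_div_iff₀ hp, div_lt_iff₀ hp]
  constructor
  · rintro ⟨h1, h2⟩
    refine ⟨?_, ?_, ?_⟩ <;> nlinarith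
  · rintro ⟨h1, h2, h3⟩
    constructor <;> nlinarith

theorem abs_hyperbolic_cos_lt_one_iff {a b d : ℝ} (ha : 0 < a) (hb : 0 < b) (hd : 0 < d) :
    |(Real.cosh b * Real.cosh d - Real.cosh a) / (Real.sinh b * Real.sinh d)| < 1 ↔
      a < b + d ∧ b < d + a ∧ d < a + b := by
  have hp : 0 < Real.sinh b * Real.sinh d :=
    mul_pos (Real.sinh_pos_iff.2 hb) (Real.sinh_pos_iff.2 hd)
  rw [abs_lt, lt_div_iff₀ hp, div_lt_iff₀ hp]
  have e1 : -1 * (Real.sinh b * Real.sinh d) < Real.cosh b * Real.cosh d - Real.cosh a ↔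
      a < b + d := by
    have := Real.cosh_lt_cosh (x := a) (y := b + d)
    rw [Real.cosh_add, abs_of_pos ha, abs_of_pos (add_pos hb hd)] at this
    rw [← this]
    constructor <;> intro h <;> linarith
  have e2 : Real.cosh b * Real.cosh d - Real.cosh a < 1 * (Real.sinh b * Real.sinh d) ↔
      b < d + a ∧ d < a + b := by
    have := Real.cosh_lt_cosh (x := b - d) (y := a)
    rw [Real.cosh_sub, abs_of_pos ha, abs_lt] at this
    constructor
    · intro h
      obtain ⟨h1, h2⟩ := this.1 (by linarith)
      constructor <;> linarith
    · rintro ⟨h1, h2⟩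
      have := this.2 ⟨by linarith, by linarith⟩
      linarith
  rw [e1, e2]

/-- Where a convex quadratic is nonnegative, lying to the right of its larger root means that its
derivative is nonnegative. If the discriminant is negative, `√` returns `0` and the threshold
becomes the vertex of the parabola, so the equivalence still holds. -/
theorem inRegion_iff {A B C κ : ℝ} (h : 0 ≤ A * κ ^ 2 + B * κ + C) :
    TriangulatedSurface.InRegion A B C κ ↔ 0 < A ∧ -(2 * A * κ + B) / 2 ≤ 0 := by
  unfold TriangulatedSurface.InRegion
  refine and_congr_right fun hA => ?_
  rw [div_le_iff₀ (by positivity)]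
  constructor
  · intro hh
    have := Real.sqrt_nonneg (B ^ 2 - 4 * A * C)
    linarith
  · intro hh
    have : √(B ^ 2 - 4 * A * C) ≤ 2 * A * κ + B := by
      rw [Real.sqrt_le_left (by linarith)]
      nlinarith
    linarith

theorem euclidean_cos_eq {e1 e2 e3 n1 n2 n3 x1 x2 x3 a b d : ℝ} (h1 : 0 < x1) (h2 : 0 < x2)
    (h3 : 0 < x3) (hN1 : 0 < sideSq 0 e2 e3 n1 x2 x3) (hN2 : 0 < sideSq 0 e3 e1 n2 x3 x1)
    (hN3 : 0 < sideSq 0 e1 e2 n3 x1 x2)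
    (ha : a = √(sideSq 0 e2 e3 n1 x2 x3) / (x2 * x3))
    (hb : b = √(sideSq 0 e3 e1 n2 x3 x1) / (x3 * x1))
    (hd : d = √(sideSq 0 e1 e2 n3 x1 x2) / (x1 * x2)) :
    (b ^ 2 + d ^ 2 - a ^ 2) / (2 * b * d) = cosNum 0 e1 n1 n2 n3 x1 x2 x3 /
      (√(sideSq 0 e3 e1 n2 x3 x1) * √(sideSq 0 e1 e2 n3 x1 x2)) := by
  have r2 := Real.sqrt_pos.2 hN2
  have r3 := Real.sqrt_pos.2 hN3
  have ha2 : a ^ 2 = sideSq 0 e2 e3 n1 x2 x3 / (x2 * x3) ^ 2 := by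
    rw [ha, div_pow, Real.sq_sqrt hN1.le]
  have hb2 : b ^ 2 = sideSq 0 e3 e1 n2 x3 x1 / (x3 * x1) ^ 2 := by
    rw [hb, div_pow, Real.sq_sqrt hN2.le]
  have hd2 : d ^ 2 = sideSq 0 e1 e2 n3 x1 x2 / (x1 * x2) ^ 2 := by
    rw [hd, div_pow, Real.sq_sqrt hN3.le]
  have hnum : b ^ 2 + d ^ 2 - a ^ 2 =
      2 * cosNum 0 e1 n1 n2 n3 x1 x2 x3 / (x1 ^ 2 * x2 * x3) := by
    rw [ha2, hb2, hd2]
    unfold sideSq cosNum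
    field_simp
    ring
  rw [hnum, hb, hd]
  field_simp

theorem hyperbolic_cos_eq {e1 n1 n2 n3 x1 x2 x3 s1 s2 s3 r2 r3 : ℝ} (h1 : 0 < s1)
    (h2 : 0 < s2) (h3 : 0 < s3) (hr2 : 0 < r2) (hr3 : 0 < r3) (hs : x1 ^ 2 - 1 * e1 = s1 ^ 2) :
    ((x3 * x1 + n2) / (s3 * s1) * ((x1 * x2 + n3) / (s1 * s2)) - (x2 * x3 + n1) / (s2 * s3)) /
      (r2 / (s3 * s1) * (r3 / (s1 * s2))) = cosNum 1 e1 n1 n2 n3 x1 x2 x3 / (r2 * r3) := by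
  have : cosNum 1 e1 n1 n2 n3 x1 x2 x3
      = (x3 * x1 + n2) * (x1 * x2 + n3) - s1 ^ 2 * (x2 * x3 + n1) := by
    rw [← hs]; unfold cosNum; ring
  rw [this]
  field_simp

end DiscreteConformal

/-! ### Lengths and cosines on the surface in normalized coordinates. -/

namespace TriangulatedSurface

open DiscreteConformal

variable {F : Type*} (T : TriangulatedSurface F) (ε : T.Vertex → ℝ) (η : T.Edge → ℝ)

theorem fin_add_one_add_one (k : Fin 3) : k + 1 + 1 = k + 2 := by omega
theorem fin_add_one_add_two (k : Fin 3) : k + 1 + 2 = k := by omega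
theorem fin_add_two_add_one (k : Fin 3) : k + 2 + 1 = k := by omega
theorem fin_add_two_add_two (k : Fin 3) : k + 2 + 2 = k + 1 := by omega

variable {T ε η}

theorem admissible (hε : ∀ v, ε v = 0 ∨ ε v = 1) (h1 : T.StructureCondition1 ε η)
    (h2 : T.StructureCondition2 ε η) (c : F × Fin 3) :
    Admissible (ε (T.vertex c)) (ε (T.vertex (c.1, c.2 + 1))) (ε (T.vertex (c.1, c.2 + 2)))
      (η (T.edge c)) (η (T.edge (c.1, c.2 + 1))) (η (T.edge (c.1, c.2 + 2))) := by
  have a1 := h1 c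
  have a2 := h1 (c.1, c.2 + 1)
  have a3 := h1 (c.1, c.2 + 2)
  have b1 := h2 c.1 c.2
  have b2 := h2 c.1 (c.2 + 1)
  have b3 := h2 c.1 (c.2 + 2)
  simp only [fin_add_one_add_one, fin_add_one_add_two, fin_add_two_add_one,
    fin_add_two_add_two] at a1 a2 a3 b1 b2 b3
  exact ⟨hε _, hε _, hε _, a1, a2, a3, b1, b2, b3⟩

variable (T ε η)

/-- The coordinate `κ` at the vertices. -/
def kappa (lam : ℝ) (f : T.Vertex → ℝ) (v : T.Vertex) : ℝ := coord lam (ε v) (f v)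

/-- The extended angle at a corner, in terms of the coordinates at the vertices. -/
def angleAt (lam : ℝ) (f : T.Vertex → ℝ) (c : F × Fin 3) : ℝ :=
  cornerAngle lam (ε (T.vertex c)) (ε (T.vertex (c.1, c.2 + 1))) (ε (T.vertex (c.1, c.2 + 2)))
    (η (T.edge c)) (η (T.edge (c.1, c.2 + 1))) (η (T.edge (c.1, c.2 + 2)))
    (T.kappa ε lam f (T.vertex c)) (T.kappa ε lam f (T.vertex (c.1, c.2 + 1)))
    (T.kappa ε lam f (T.vertex (c.1, c.2 + 2)))

/-- The normalized squared area of a triangle, computed from one of its corners. -/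
def areaAt (lam : ℝ) (f : T.Vertex → ℝ) (c : F × Fin 3) : ℝ :=
  areaSq lam (ε (T.vertex c)) (ε (T.vertex (c.1, c.2 + 1))) (ε (T.vertex (c.1, c.2 + 2)))
    (η (T.edge c)) (η (T.edge (c.1, c.2 + 1))) (η (T.edge (c.1, c.2 + 2)))
    (T.kappa ε lam f (T.vertex c)) (T.kappa ε lam f (T.vertex (c.1, c.2 + 1)))
    (T.kappa ε lam f (T.vertex (c.1, c.2 + 2)))

/-- The normalized squared length of a side. -/
def sideAt (lam : ℝ) (f : T.Vertex → ℝ) (c : F × Fin 3) : ℝ :=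
  sideSq lam (ε (T.vertex (c.1, c.2 + 1))) (ε (T.vertex (c.1, c.2 + 2))) (η (T.edge c))
    (T.kappa ε lam f (T.vertex (c.1, c.2 + 1))) (T.kappa ε lam f (T.vertex (c.1, c.2 + 2)))

theorem areaAt_rotate (lam : ℝ) (f : T.Vertex → ℝ) (c : F × Fin 3) :
    T.areaAt ε η lam f c = T.areaAt ε η lam f (c.1, c.2 + 1) := by
  unfold areaAt
  rw [areaSq_rotate]
  simp only [fin_add_one_add_one, fin_add_one_add_two]

theorem areaAt_eq (lam : ℝ) (f : T.Vertex → ℝ) (t : F) (j k : Fin 3) :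
    T.areaAt ε η lam f (t, j) = T.areaAt ε η lam f (t, k) := by
  have h0 := T.areaAt_rotate ε η lam f (t, 0)
  have h1 := T.areaAt_rotate ε η lam f (t, 1)
  change _ = T.areaAt ε η lam f (t, 1) at h0
  change _ = T.areaAt ε η lam f (t, 2) at h1
  fin_cases j <;> fin_cases k <;> simp_all

variable {T ε η}

theorem inRange_kappa (hε : ∀ v, ε v = 0 ∨ ε v = 1) {lam : ℝ} (hl : lam = 0 ∨ lam = 1)
    (f : T.Vertex → ℝ) (v : T.Vertex) : InRange lam (ε v) (T.kappa ε lam f v) :=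
  inRange_coord (hε v) hl (f v)

theorem kappa_sq (hε : ∀ v, ε v = 0 ∨ ε v = 1) {lam : ℝ} (hl : lam = 0 ∨ lam = 1)
    (f : T.Vertex → ℝ) (v : T.Vertex) :
    T.kappa ε lam f v ^ 2 - lam * ε v = Real.exp (-f v) ^ 2 :=
  coord_sq (hε v) hl (f v)

theorem sideAt_pos (hε : ∀ v, ε v = 0 ∨ ε v = 1) (h1 : T.StructureCondition1 ε η) {lam : ℝ}
    (hl : lam = 0 ∨ lam = 1) (f : T.Vertex → ℝ) (c : F × Fin 3) : 0 < T.sideAt ε η lam f c :=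
  sideSq_pos hl (hε _) (hε _) (h1 c) (inRange_kappa hε hl f _) (inRange_kappa hε hl f _)

theorem euclideanLength_eq (f : T.Vertex → ℝ) (c : F × Fin 3) :
    T.euclideanLength ε η f (T.edge c) = √(T.sideAt ε η 0 f c) /
      (T.kappa ε 0 f (T.vertex (c.1, c.2 + 1)) * T.kappa ε 0 f (T.vertex (c.1, c.2 + 2))) := by
  have hk : ∀ v, T.kappa ε 0 f v = (Real.exp (f v))⁻¹ := fun v => by simp [kappa, coord]
  change √(_ + _) = _
  rw [eq_div_iff (by rw [hk, hk]; positivity)]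
  conv_lhs => rw [← Real.sqrt_sq (show 0 ≤ T.kappa ε 0 f (T.vertex (c.1, c.2 + 1)) *
    T.kappa ε 0 f (T.vertex (c.1, c.2 + 2)) by rw [hk, hk]; positivity)]
  rw [← Real.sqrt_mul' _ (sq_nonneg _)]
  congr 1
  unfold sideAt sideSq
  rw [hk, hk, two_mul (f _), two_mul (f _), Real.exp_add, Real.exp_add, Real.exp_add]
  field_simp
  ring

theorem cosh_hyperbolicLength (hε : ∀ v, ε v = 0 ∨ ε v = 1) (h1 : T.StructureCondition1 ε η)
    (f : T.Vertex → ℝ) (c : F × Fin 3) :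
    0 < T.hyperbolicLength ε η f (T.edge c) ∧
    Real.cosh (T.hyperbolicLength ε η f (T.edge c)) =
      (T.kappa ε 1 f (T.vertex (c.1, c.2 + 1)) * T.kappa ε 1 f (T.vertex (c.1, c.2 + 2))
        + η (T.edge c)) /
      (Real.exp (-f (T.vertex (c.1, c.2 + 1))) * Real.exp (-f (T.vertex (c.1, c.2 + 2)))) ∧
    Real.sinh (T.hyperbolicLength ε η f (T.edge c)) = √(T.sideAt ε η 1 f c) /
      (Real.exp (-f (T.vertex (c.1, c.2 + 1))) * Real.exp (-f (T.vertex (c.1, c.2 + 2)))) := by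
  have hl : (1 : ℝ) = 0 ∨ (1 : ℝ) = 1 := Or.inr rfl
  have hN := sideAt_pos hε h1 hl f c
  have hp := mixed_pos hl (hε _) (hε _) (h1 c) (inRange_kappa hε hl f (T.vertex (c.1, c.2 + 1)))
    (inRange_kappa hε hl f (T.vertex (c.1, c.2 + 2)))
  have hms := mixed_sq_sub 1 (ε (T.vertex (c.1, c.2 + 1))) (ε (T.vertex (c.1, c.2 + 2)))
    (η (T.edge c)) (T.kappa ε 1 f (T.vertex (c.1, c.2 + 1)))
    (T.kappa ε 1 f (T.vertex (c.1, c.2 + 2)))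
  have q1 := kappa_sq hε hl f (T.vertex (c.1, c.2 + 1))
  have q2 := kappa_sq hε hl f (T.vertex (c.1, c.2 + 2))
  have hdef : T.hyperbolicLength ε η f (T.edge c) = Real.arcosh
      ((T.kappa ε 1 f (T.vertex (c.1, c.2 + 1)) * T.kappa ε 1 f (T.vertex (c.1, c.2 + 2))
        + η (T.edge c)) /
      (Real.exp (-f (T.vertex (c.1, c.2 + 1))) * Real.exp (-f (T.vertex (c.1, c.2 + 2))))) := by
    change Real.arcosh (√(_ * _) + _) = _
    congr 1
    unfold kappa coord
    rw [Real.sqrt_mul (by have := weight_nonneg (hε (T.vertex (c.1, c.2 + 1))); positivity),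
      Real.exp_neg, Real.exp_neg, Real.exp_add]
    field_simp
  have hNdef : sideSq 1 (ε (T.vertex (c.1, c.2 + 1))) (ε (T.vertex (c.1, c.2 + 2)))
    (η (T.edge c)) (T.kappa ε 1 f (T.vertex (c.1, c.2 + 1)))
    (T.kappa ε 1 f (T.vertex (c.1, c.2 + 2))) = T.sideAt ε η 1 f c := rfl
  rw [hNdef] at hms
  rw [q1, q2] at hms
  rw [hdef]
  have p1 := Real.exp_pos (-f (T.vertex (c.1, c.2 + 1)))
  have p2 := Real.exp_pos (-f (T.vertex (c.1, c.2 + 2)))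
  generalize T.sideAt ε η 1 f c = N at *
  generalize T.kappa ε 1 f (T.vertex (c.1, c.2 + 1)) = y1 at *
  generalize T.kappa ε 1 f (T.vertex (c.1, c.2 + 2)) = y2 at *
  generalize Real.exp (-f (T.vertex (c.1, c.2 + 1))) = u1 at *
  generalize Real.exp (-f (T.vertex (c.1, c.2 + 2))) = u2 at *
  have hu := mul_pos p1 p2
  rw [one_mul] at hp hms
  -- The argument of `Real.arcosh` is in its genuine range: by `mixed_sq_sub` the numerator squared
  -- exceeds the denominator squared by the normalized squared side.
  have hone : 1 < (y1 * y2 + η (T.edge c)) / (u1 * u2) := by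
    rw [one_lt_div hu]
    exact lt_of_pow_lt_pow_left₀ 2 hp.le (by nlinarith)
  refine ⟨Real.arcosh_pos hone, Real.cosh_arcosh hone.le, ?_⟩
  rw [Real.sinh_arcosh hone.le, ← Real.sqrt_sq hu.le, ← Real.sqrt_div' _ (sq_nonneg _),
    Real.sqrt_sq hu.le]
  congr 1
  have : N = (y1 * y2 + η (T.edge c)) ^ 2 - (u1 * u2) ^ 2 := by linarith
  rw [this]
  field_simp

theorem euclideanLength_pos (hε : ∀ v, ε v = 0 ∨ ε v = 1) (h1 : T.StructureCondition1 ε η)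
    (f : T.Vertex → ℝ) (c : F × Fin 3) : 0 < T.euclideanLength ε η f (T.edge c) := by
  have hl : (0 : ℝ) = 0 ∨ (0 : ℝ) = 1 := Or.inl rfl
  rw [euclideanLength_eq]
  exact div_pos (Real.sqrt_pos.2 (sideAt_pos hε h1 hl f c))
    (mul_pos (inRange_kappa hε hl f _).pos (inRange_kappa hε hl f _).pos)

theorem euclidean_cos (hε : ∀ v, ε v = 0 ∨ ε v = 1) (h1 : T.StructureCondition1 ε η)
    (f : T.Vertex → ℝ) (c : F × Fin 3) :
    (T.euclideanLength ε η f (T.edge (c.1, c.2 + 1)) ^ 2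
        + T.euclideanLength ε η f (T.edge (c.1, c.2 + 2)) ^ 2
        - T.euclideanLength ε η f (T.edge (c.1, c.2)) ^ 2) /
      (2 * T.euclideanLength ε η f (T.edge (c.1, c.2 + 1)) *
        T.euclideanLength ε η f (T.edge (c.1, c.2 + 2)))
      = cosNum 0 (ε (T.vertex c)) (η (T.edge c)) (η (T.edge (c.1, c.2 + 1)))
        (η (T.edge (c.1, c.2 + 2))) (T.kappa ε 0 f (T.vertex c))
        (T.kappa ε 0 f (T.vertex (c.1, c.2 + 1))) (T.kappa ε 0 f (T.vertex (c.1, c.2 + 2))) /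
        (√(T.sideAt ε η 0 f (c.1, c.2 + 1)) * √(T.sideAt ε η 0 f (c.1, c.2 + 2))) := by
  have hl : (0 : ℝ) = 0 ∨ (0 : ℝ) = 1 := Or.inl rfl
  have N1 := sideAt_pos hε h1 hl f c
  have N2 := sideAt_pos hε h1 hl f (c.1, c.2 + 1)
  have N3 := sideAt_pos hε h1 hl f (c.1, c.2 + 2)
  have l1 := euclideanLength_eq (ε := ε) (η := η) f c
  have l2 := euclideanLength_eq (ε := ε) (η := η) f (c.1, c.2 + 1)
  have l3 := euclideanLength_eq (ε := ε) (η := η) f (c.1, c.2 + 2)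
  simp only [sideAt, fin_add_one_add_one, fin_add_one_add_two, fin_add_two_add_one,
    fin_add_two_add_two] at l1 l2 l3 N1 N2 N3 ⊢
  exact euclidean_cos_eq (inRange_kappa hε hl f _).pos (inRange_kappa hε hl f _).pos
    (inRange_kappa hε hl f _).pos N1 N2 N3 l1 l2 l3

theorem hyperbolic_cos (hε : ∀ v, ε v = 0 ∨ ε v = 1) (h1 : T.StructureCondition1 ε η)
    (f : T.Vertex → ℝ) (c : F × Fin 3) :
    (Real.cosh (T.hyperbolicLength ε η f (T.edge (c.1, c.2 + 1))) *
        Real.cosh (T.hyperbolicLength ε η f (T.edge (c.1, c.2 + 2)))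
        - Real.cosh (T.hyperbolicLength ε η f (T.edge (c.1, c.2)))) /
      (Real.sinh (T.hyperbolicLength ε η f (T.edge (c.1, c.2 + 1))) *
        Real.sinh (T.hyperbolicLength ε η f (T.edge (c.1, c.2 + 2))))
      = cosNum 1 (ε (T.vertex c)) (η (T.edge c)) (η (T.edge (c.1, c.2 + 1)))
        (η (T.edge (c.1, c.2 + 2))) (T.kappa ε 1 f (T.vertex c))
        (T.kappa ε 1 f (T.vertex (c.1, c.2 + 1))) (T.kappa ε 1 f (T.vertex (c.1, c.2 + 2))) /
        (√(T.sideAt ε η 1 f (c.1, c.2 + 1)) * √(T.sideAt ε η 1 f (c.1, c.2 + 2))) := by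
  have hl : (1 : ℝ) = 0 ∨ (1 : ℝ) = 1 := Or.inr rfl
  have N2 := sideAt_pos hε h1 hl f (c.1, c.2 + 1)
  have N3 := sideAt_pos hε h1 hl f (c.1, c.2 + 2)
  obtain ⟨-, l1, -⟩ := cosh_hyperbolicLength hε h1 f c
  obtain ⟨-, l2, l2'⟩ := cosh_hyperbolicLength hε h1 f (c.1, c.2 + 1)
  obtain ⟨-, l3, l3'⟩ := cosh_hyperbolicLength hε h1 f (c.1, c.2 + 2)
  simp only [fin_add_one_add_one, fin_add_one_add_two, fin_add_two_add_one,
    fin_add_two_add_two] at l1 l2 l3 l2' l3'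
  rw [l1, l2, l3, l2', l3']
  exact hyperbolic_cos_eq (Real.exp_pos _) (Real.exp_pos _) (Real.exp_pos _)
    (Real.sqrt_pos.2 N2) (Real.sqrt_pos.2 N3) (kappa_sq hε hl f _)

end TriangulatedSurface

/-! ### Extended angles in normalized form, and global rigidity. -/

namespace TriangulatedSurface

open DiscreteConformal

variable {F : Type*} {T : TriangulatedSurface F} {ε : T.Vertex → ℝ} {η : T.Edge → ℝ}

theorem euclideanAngle_eq (hε : ∀ v, ε v = 0 ∨ ε v = 1) (h1 : T.StructureCondition1 ε η)
    (f : T.Vertex → ℝ) (c : F × Fin 3) :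
    T.euclideanAngle (T.euclideanLength ε η f) c = T.angleAt ε η 0 f c := by
  unfold euclideanAngle angleAt cornerAngle
  refine (congrArg Real.arccos (euclidean_cos hε h1 f c)).trans ?_
  simp only [sideAt, fin_add_one_add_one, fin_add_one_add_two, fin_add_two_add_one,
    fin_add_two_add_two]

theorem hyperbolicAngle_eq (hε : ∀ v, ε v = 0 ∨ ε v = 1) (h1 : T.StructureCondition1 ε η)
    (f : T.Vertex → ℝ) (c : F × Fin 3) :
    T.hyperbolicAngle (T.hyperbolicLength ε η f) c = T.angleAt ε η 1 f c := by
  unfold hyperbolicAngle angleAt cornerAngle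
  refine (congrArg Real.arccos (hyperbolic_cos hε h1 f c)).trans ?_
  simp only [sideAt, fin_add_one_add_one, fin_add_one_add_two, fin_add_two_add_one,
    fin_add_two_add_two]

theorem areaAt_pos_iff (hε : ∀ v, ε v = 0 ∨ ε v = 1) (h1 : T.StructureCondition1 ε η)
    (h2 : T.StructureCondition2 ε η) {lam : ℝ} (hl : lam = 0 ∨ lam = 1) (f : T.Vertex → ℝ)
    (c : F × Fin 3) :
    0 < T.areaAt ε η lam f c ↔
      |cosNum lam (ε (T.vertex c)) (η (T.edge c)) (η (T.edge (c.1, c.2 + 1)))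
        (η (T.edge (c.1, c.2 + 2))) (T.kappa ε lam f (T.vertex c))
        (T.kappa ε lam f (T.vertex (c.1, c.2 + 1))) (T.kappa ε lam f (T.vertex (c.1, c.2 + 2))) /
        (√(T.sideAt ε η lam f (c.1, c.2 + 1)) * √(T.sideAt ε η lam f (c.1, c.2 + 2)))| < 1 := by
  have N2 := Real.sqrt_pos.2 (sideAt_pos hε h1 hl f (c.1, c.2 + 1))
  have N3 := Real.sqrt_pos.2 (sideAt_pos hε h1 hl f (c.1, c.2 + 2))
  rw [abs_div, abs_of_pos (mul_pos N2 N3), div_lt_one (mul_pos N2 N3)]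
  have := areaSq_pos_iff hl (admissible hε h1 h2 c) (inRange_kappa hε hl f _)
    (inRange_kappa hε hl f _) (inRange_kappa hε hl f _)
  simp only [sideAt, fin_add_one_add_one, fin_add_one_add_two, fin_add_two_add_one,
    fin_add_two_add_two]
  exact this

theorem nondegenerate_iff_of_forall {lam : ℝ} {f : T.Vertex → ℝ} {l : T.Edge → ℝ}
    (h : ∀ c : F × Fin 3, 0 < T.areaAt ε η lam f c ↔
      l (T.edge c) < l (T.edge (c.1, c.2 + 1)) + l (T.edge (c.1, c.2 + 2)) ∧
      l (T.edge (c.1, c.2 + 1)) < l (T.edge (c.1, c.2 + 2)) + l (T.edge c) ∧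
      l (T.edge (c.1, c.2 + 2)) < l (T.edge c) + l (T.edge (c.1, c.2 + 1)))
    (c : F × Fin 3) : T.Nondegenerate l c.1 ↔ 0 < T.areaAt ε η lam f c := by
  constructor
  · intro hn
    have a1 := hn c.2
    have a2 := hn (c.2 + 1)
    have a3 := hn (c.2 + 2)
    simp only [fin_add_one_add_one, fin_add_one_add_two, fin_add_two_add_one,
      fin_add_two_add_two] at a1 a2 a3
    exact (h c).2 ⟨a1, a2, a3⟩
  · intro hpos k
    have hpos' : 0 < T.areaAt ε η lam f (c.1, k) := by
      rwa [T.areaAt_eq ε η lam f c.1 k c.2]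
    exact ((h (c.1, k)).1 hpos').1

theorem nondegenerate_euclidean_iff (hε : ∀ v, ε v = 0 ∨ ε v = 1)
    (h1 : T.StructureCondition1 ε η) (h2 : T.StructureCondition2 ε η) (f : T.Vertex → ℝ)
    (c : F × Fin 3) :
    T.Nondegenerate (T.euclideanLength ε η f) c.1 ↔ 0 < T.areaAt ε η 0 f c := by
  refine nondegenerate_iff_of_forall (fun c => ?_) c
  rw [areaAt_pos_iff hε h1 h2 (Or.inl rfl), ← euclidean_cos hε h1]
  exact abs_euclidean_cos_lt_one_iff (euclideanLength_pos hε h1 f _)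
    (euclideanLength_pos hε h1 f _) (euclideanLength_pos hε h1 f _)

theorem nondegenerate_hyperbolic_iff (hε : ∀ v, ε v = 0 ∨ ε v = 1)
    (h1 : T.StructureCondition1 ε η) (h2 : T.StructureCondition2 ε η) (f : T.Vertex → ℝ)
    (c : F × Fin 3) :
    T.Nondegenerate (T.hyperbolicLength ε η f) c.1 ↔ 0 < T.areaAt ε η 1 f c := by
  refine nondegenerate_iff_of_forall (fun c => ?_) c
  rw [areaAt_pos_iff hε h1 h2 (Or.inr rfl), ← hyperbolic_cos hε h1]
  exact abs_hyperbolic_cos_lt_one_iff (cosh_hyperbolicLength hε h1 f _).1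
    (cosh_hyperbolicLength hε h1 f _).1 (cosh_hyperbolicLength hε h1 f _).1

theorem termG_eq (c : F × Fin 3) : T.termG ε η c.1 =
    gramDet (ε (T.vertex c)) (ε (T.vertex (c.1, c.2 + 1))) (ε (T.vertex (c.1, c.2 + 2)))
      (η (T.edge c)) (η (T.edge (c.1, c.2 + 1))) (η (T.edge (c.1, c.2 + 2))) := by
  obtain ⟨t, k⟩ := c
  have h0 : T.termG ε η t = gramDet (ε (T.vertex (t, 0))) (ε (T.vertex (t, 1)))
      (ε (T.vertex (t, 2))) (η (T.edge (t, 0))) (η (T.edge (t, 1))) (η (T.edge (t, 2))) := by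
    simp only [termG, gramDet, Fin.sum_univ_three, Fin.prod_univ_three]
  rw [h0]
  fin_cases k
  · rfl
  · exact gramDet_rotate _ _ _ _ _ _
  · exact (gramDet_rotate _ _ _ _ _ _).trans (gramDet_rotate _ _ _ _ _ _)

/-- The quadratic in `κ_i` whose larger root bounds `V_i` is minus the area, and the height is minus
half its derivative. With `inRegion_iff` this identifies `V_i` with the geometric condition of
`cosNum_neg_iff`. -/
theorem coeff_eq (lam : ℝ) (f : T.Vertex → ℝ) (c : F × Fin 3) :
    T.coeffA ε η c * T.kappa ε lam f (T.vertex c) ^ 2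
        + T.coeffB ε η (T.kappa ε lam f) c * T.kappa ε lam f (T.vertex c)
        + (T.coeffC ε η (T.kappa ε lam f) c - lam * T.termG ε η c.1)
      = -T.areaAt ε η lam f c ∧
    -(2 * T.coeffA ε η c * T.kappa ε lam f (T.vertex c)
        + T.coeffB ε η (T.kappa ε lam f) c) / 2
      = height (ε (T.vertex (c.1, c.2 + 1))) (ε (T.vertex (c.1, c.2 + 2)))
        (η (T.edge c)) (η (T.edge (c.1, c.2 + 1))) (η (T.edge (c.1, c.2 + 2)))
        (T.kappa ε lam f (T.vertex c)) (T.kappa ε lam f (T.vertex (c.1, c.2 + 1)))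
        (T.kappa ε lam f (T.vertex (c.1, c.2 + 2))) := by
  rw [termG_eq]
  simp only [coeffA, coeffB, coeffC, gam, areaAt, areaSq, height, fin_add_one_add_one,
    fin_add_one_add_two, fin_add_two_add_one, fin_add_two_add_two]
  constructor <;> ring

/-- In a degenerate triangle, the angle is `π` in the degenerate region of the corner, and `0`
otherwise. -/
theorem angleAt_of_degenerate (hε : ∀ v, ε v = 0 ∨ ε v = 1) (h1 : T.StructureCondition1 ε η)
    (h2 : T.StructureCondition2 ε η) {lam : ℝ} (hl : lam = 0 ∨ lam = 1) (f : T.Vertex → ℝ)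
    (c : F × Fin 3) (hQ : T.areaAt ε η lam f c ≤ 0) :
    (InRegion (T.coeffA ε η c) (T.coeffB ε η (T.kappa ε lam f) c)
        (T.coeffC ε η (T.kappa ε lam f) c - lam * T.termG ε η c.1)
        (T.kappa ε lam f (T.vertex c)) ∧ T.angleAt ε η lam f c = Real.pi) ∨
    (¬InRegion (T.coeffA ε η c) (T.coeffB ε η (T.kappa ε lam f) c)
        (T.coeffC ε η (T.kappa ε lam f) c - lam * T.termG ε η c.1)
        (T.kappa ε lam f (T.vertex c)) ∧ T.angleAt ε η lam f c = 0) := by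
  obtain ⟨e1, e2⟩ := T.coeff_eq (ε := ε) (η := η) lam f c
  rw [inRegion_iff (by rw [e1]; linarith), e2, and_assoc]
  exact cornerAngle_of_degenerate hl (admissible hε h1 h2 c) (inRange_kappa hε hl f _)
    (inRange_kappa hε hl f _) (inRange_kappa hε hl f _) hQ

theorem euclideanExtAngle_eq (hε : ∀ v, ε v = 0 ∨ ε v = 1) (h1 : T.StructureCondition1 ε η)
    (h2 : T.StructureCondition2 ε η) (f : T.Vertex → ℝ) :
    T.euclideanExtAngle ε η f = T.angleAt ε η 0 f := by
  funext c
  unfold euclideanExtAngle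
  have hk : (fun v => (Real.exp (f v))⁻¹) = T.kappa ε 0 f := by
    funext v; simp [kappa, coord]
  have hreg : T.InEuclideanRegion ε η f c = InRegion (T.coeffA ε η c) (T.coeffB ε η (T.kappa ε 0 f) c)
      (T.coeffC ε η (T.kappa ε 0 f) c) (T.kappa ε 0 f (T.vertex c)) := by
    rw [← hk]; rfl
  split_ifs with hn hr
  · exact euclideanAngle_eq hε h1 f c
  all_goals
    rw [nondegenerate_euclidean_iff hε h1 h2, not_lt] at hn
    have := angleAt_of_degenerate hε h1 h2 (Or.inl rfl) f c hn
    rw [zero_mul, sub_zero] at this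
    rw [← hreg] at this
    rcases this with ⟨r, r'⟩ | ⟨r, r'⟩
    · first | exact r'.symm | exact absurd r hr
    · first | exact r'.symm | exact absurd hr r

theorem hyperbolicExtAngle_eq (hε : ∀ v, ε v = 0 ∨ ε v = 1) (h1 : T.StructureCondition1 ε η)
    (h2 : T.StructureCondition2 ε η) (f : T.Vertex → ℝ) :
    T.hyperbolicExtAngle ε η f = T.angleAt ε η 1 f := by
  funext c
  unfold hyperbolicExtAngle
  have hk : (fun v => √(1 + ε v * Real.exp (2 * f v)) / Real.exp (f v)) = T.kappa ε 1 f := by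
    funext v; simp [kappa, coord]
  have hreg : T.InHyperbolicRegion ε η f c = InRegion (T.coeffA ε η c) (T.coeffB ε η (T.kappa ε 1 f) c)
      (T.coeffC ε η (T.kappa ε 1 f) c - T.termG ε η c.1) (T.kappa ε 1 f (T.vertex c)) := by
    rw [← hk]; rfl
  split_ifs with hn hr
  · exact hyperbolicAngle_eq hε h1 f c
  all_goals
    rw [nondegenerate_hyperbolic_iff hε h1 h2, not_lt] at hn
    have := angleAt_of_degenerate hε h1 h2 (Or.inr rfl) f c hn
    rw [one_mul] at this
    rw [← hreg] at this
    rcases this with ⟨r, r'⟩ | ⟨r, r'⟩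
    · first | exact r'.symm | exact absurd r hr
    · first | exact r'.symm | exact absurd hr r

/-- Grouping the corners by vertex shows that the pairing of the angles with a function on vertices
depends only on the curvature. -/
theorem sum_sub_mul_eq_zero_of_curvature_eq [Fintype F] {θ θ' : F × Fin 3 → ℝ}
    (h : T.curvature θ = T.curvature θ') (w : T.Vertex → ℝ) :
    ∑ c, θ c * w (T.vertex c) = ∑ c, θ' c * w (T.vertex c) := by
  classical
  have key : ∀ θ : F × Fin 3 → ℝ, ∑ c, θ c * w (T.vertex c)
      = ∑ v ∈ Finset.univ.image T.vertex, (2 * Real.pi - T.curvature θ v) * w v := by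
    intro θ
    rw [← Finset.sum_fiberwise_of_maps_to (t := Finset.univ.image T.vertex) (g := T.vertex)
      (fun c _ => Finset.mem_image_of_mem _ (Finset.mem_univ c))]
    refine Finset.sum_congr rfl fun v _ => ?_
    have : 2 * Real.pi - T.curvature θ v = ∑ c with T.vertex c = v, θ c := by
      unfold curvature
      rw [sub_sub_cancel]
    rw [this, Finset.sum_mul]
    refine Finset.sum_congr rfl fun c hc => ?_
    rw [(Finset.mem_filter.1 hc).2]
  rw [key, key, h]

/-- Triangles with glued sides share the end points of the side, so the common value propagates
along chains. -/
theorem eq_of_connected (hT : T.Connected) {w : T.Vertex → ℝ}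
    (h : ∀ t, w (T.vertex (t, 0)) = w (T.vertex (t, 1)) ∧
      w (T.vertex (t, 1)) = w (T.vertex (t, 2))) (v v' : T.Vertex) : w v = w v' := by
  have hk : ∀ t j k, w (T.vertex (t, j)) = w (T.vertex (t, k)) := by
    intro t j k
    obtain ⟨a, b⟩ := h t
    fin_cases j <;> fin_cases k <;> simp_all
  obtain ⟨⟨t, k⟩, rfl⟩ := Quot.exists_rep v
  obtain ⟨⟨t', k'⟩, rfl⟩ := Quot.exists_rep v'
  change w (T.vertex (t, k)) = w (T.vertex (t', k'))
  have hr := hT.2 t t'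
  have : w (T.vertex (t, 0)) = w (T.vertex (t', 0)) := by
    induction hr with
    | refl => rfl
    | tail _ hs ih =>
      rename_i a b _
      obtain ⟨i, j, hij⟩ := hs
      rw [ih]
      have hv := T.endpoints_mate (a, i)
      rw [hij] at hv
      simp only [endpoints, Sym2.eq_iff] at hv
      rcases hv with ⟨r, -⟩ | ⟨r, -⟩
      · rw [hk a 0 (i + 1), ← r]; exact hk _ _ _
      · rw [hk a 0 (i + 2), ← r]; exact hk _ _ _
  rw [hk t k 0, this]
  exact hk _ _ _

/-- Global rigidity: the curvature of a nondegenerate structure determines it among all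
generalized structures. -/
theorem logCoord_sub_eq [Fintype F] (hT : T.Connected) (hε : ∀ v, ε v = 0 ∨ ε v = 1)
    (h1 : T.StructureCondition1 ε η) (h2 : T.StructureCondition2 ε η) {lam : ℝ}
    (hl : lam = 0 ∨ lam = 1) {f g : T.Vertex → ℝ} (hf : ∀ c, 0 < T.areaAt ε η lam f c)
    (heq : T.curvature (T.angleAt ε η lam f) = T.curvature (T.angleAt ε η lam g)) :
    ∃ a, (lam = 1 → a = 0) ∧ ∀ v, logCoord lam (ε v) (g v) - logCoord lam (ε v) (f v) = a := by
  set w : T.Vertex → ℝ := fun v => logCoord lam (ε v) (g v) - logCoord lam (ε v) (f v) with hw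
  have hpath := fun v => exists_isPath hl (hε v) (f v) (g v)
  choose x s hxs hx0 hx1 using hpath
  have hsum := sum_sub_mul_eq_zero_of_curvature_eq heq w
  rw [Fintype.sum_prod_type, Fintype.sum_prod_type] at hsum
  have hwork : ∀ h t, ∑ k, T.angleAt ε η lam h (t, k) * w (T.vertex (t, k))
      = angleWork lam (ε (T.vertex (t, 0))) (ε (T.vertex (t, 1))) (ε (T.vertex (t, 2)))
        (η (T.edge (t, 0))) (η (T.edge (t, 1))) (η (T.edge (t, 2)))
        (w (T.vertex (t, 0))) (w (T.vertex (t, 1))) (w (T.vertex (t, 2)))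
        (T.kappa ε lam h (T.vertex (t, 0))) (T.kappa ε lam h (T.vertex (t, 1)))
        (T.kappa ε lam h (T.vertex (t, 2))) := by
    intro h t
    rw [Fin.sum_univ_three]
    rfl
  have hmono := fun t => angleWork_monotone hl (admissible hε h1 h2 (t, 0))
    (hxs (T.vertex (t, 0))) (hxs (T.vertex (t, 1))) (hxs (T.vertex (t, 2)))
    (by rw [hx0, hx0, hx0]; exact hf (t, 0))
  have hmono' : ∀ t, ∑ k, T.angleAt ε η lam f (t, k) * w (T.vertex (t, k)) ≤
      ∑ k, T.angleAt ε η lam g (t, k) * w (T.vertex (t, k)) ∧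
      (∑ k, T.angleAt ε η lam f (t, k) * w (T.vertex (t, k)) =
        ∑ k, T.angleAt ε η lam g (t, k) * w (T.vertex (t, k)) →
        w (T.vertex (t, 0)) = w (T.vertex (t, 1)) ∧ w (T.vertex (t, 1)) = w (T.vertex (t, 2)) ∧
          (lam = 1 → w (T.vertex (t, 0)) = 0)) := by
    intro t
    have := hmono t
    simp only [hx0, hx1] at this
    rw [hwork, hwork]
    exact this
  -- The work of each triangle can only grow while the total is unchanged, so every triangle is in
  -- the equality case.
  have hall := (Finset.sum_eq_sum_iff_of_le fun t _ => (hmono' t).1).1 hsum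
  have hconst := fun t => (hmono' t).2 (hall t (Finset.mem_univ t))
  obtain ⟨t0⟩ := hT.1
  exact ⟨w (T.vertex (t0, 0)), (hconst t0).2.2, fun v =>
    eq_of_connected hT (fun t => ⟨(hconst t).1, (hconst t).2.1⟩) v _⟩

theorem euclideanLength_add_const (f : T.Vertex → ℝ) (a : ℝ) (e : T.Edge) :
    T.euclideanLength ε η (fun v => f v + a) e = Real.exp a * T.euclideanLength ε η f e := by
  obtain ⟨c, rfl⟩ := Quot.exists_rep e
  change √(_ + _) = Real.exp a * √(_ + _)
  conv_rhs => rw [← Real.sqrt_sq (Real.exp_pos a).le, ← Real.sqrt_mul (sq_nonneg _)]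
  congr 1
  simp only [mul_add, two_mul, Real.exp_add]
  ring

theorem euclideanAngle_smul {r : ℝ} (hr : 0 < r) (l : T.Edge → ℝ) :
    T.euclideanAngle (fun e => r * l e) = T.euclideanAngle l := by
  funext c
  simp only [euclideanAngle]
  congr 1
  refine Eq.trans ?_ (mul_div_mul_left _ _ (pow_pos hr 2).ne')
  congr 1 <;> ring

theorem isPolyhedralMetric_smul {r : ℝ} (hr : 0 < r) {l : T.Edge → ℝ}
    (h : T.IsPolyhedralMetric l) : T.IsPolyhedralMetric (fun e => r * l e) := by
  refine ⟨fun e => mul_pos hr (h.1 e), fun t k => ?_⟩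
  have := mul_lt_mul_of_pos_left (h.2 t k) hr
  linarith

end TriangulatedSurface

end

/-! ### The four rigidity statements. -/

open TriangulatedSurface DiscreteConformal in
theorem theorem1p1 {F : Type*} [Fintype F] (T : TriangulatedSurface F) (hT : T.Connected)
    (ε : T.Vertex → ℝ) (η : T.Edge → ℝ) (hε : ∀ v, ε v = 0 ∨ ε v = 1)
    (h1 : T.StructureCondition1 ε η) (h2 : T.StructureCondition2 ε η) :
    -- Euclidean structures: the curvature determines `f` exactly up to constant vectors
    (∀ f : T.Vertex → ℝ, T.IsEuclideanDCS ε η f → ∀ f' : T.Vertex → ℝ,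
      (T.IsEuclideanDCS ε η f' ∧ T.euclideanCurvature ε η f' = T.euclideanCurvature ε η f) ↔
        ∃ c : ℝ, ∀ v, f' v = f v + c) ∧
    -- hyperbolic structures: the curvature determines `f`
    (∀ f f' : T.Vertex → ℝ, T.IsHyperbolicDCS ε η f → T.IsHyperbolicDCS ε η f' →
      T.hyperbolicCurvature ε η f = T.hyperbolicCurvature ε η f' → f = f') ∧
    -- one Euclidean structure, and one generalized Euclidean structure
    (∀ fA : T.Vertex → ℝ, T.IsEuclideanDCS ε η fA → ∀ fB : T.Vertex → ℝ,
      T.euclideanCurvature ε η fA = T.euclideanExtCurvature ε η fB →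
        ∃ c : ℝ, 0 < c ∧ ∀ v, Real.exp (fA v) = c * Real.exp (fB v)) ∧
    -- one hyperbolic structure, and one generalized hyperbolic structure
    (∀ fA : T.Vertex → ℝ, T.IsHyperbolicDCS ε η fA → ∀ fB : T.Vertex → ℝ,
      T.hyperbolicCurvature ε η fA = T.hyperbolicExtCurvature ε η fB → fA = fB) := by
  -- Ordinary and extended curvatures are both the curvature of `angleAt`, so one rigidity statement
  -- in each geometry, `euc` and `hyp`, gives all the uniqueness claims.
  have hE : ∀ f, T.euclideanCurvature ε η f = T.curvature (T.angleAt ε η 0 f) := fun f =>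
    congrArg T.curvature (funext (euclideanAngle_eq hε h1 f))
  have hH : ∀ f, T.hyperbolicCurvature ε η f = T.curvature (T.angleAt ε η 1 f) := fun f =>
    congrArg T.curvature (funext (hyperbolicAngle_eq hε h1 f))
  have hEx : ∀ f, T.euclideanExtCurvature ε η f = T.curvature (T.angleAt ε η 0 f) := fun f =>
    congrArg T.curvature (euclideanExtAngle_eq hε h1 h2 f)
  have hHx : ∀ f, T.hyperbolicExtCurvature ε η f = T.curvature (T.angleAt ε η 1 f) := fun f =>
    congrArg T.curvature (hyperbolicExtAngle_eq hε h1 h2 f)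
  have euc : ∀ f g : T.Vertex → ℝ, T.IsEuclideanDCS ε η f →
      T.curvature (T.angleAt ε η 0 f) = T.curvature (T.angleAt ε η 0 g) →
      ∃ a, ∀ v, g v = f v + a := by
    intro f g hf heq
    obtain ⟨a, -, ha⟩ := logCoord_sub_eq hT hε h1 h2 (Or.inl rfl)
      (fun c => (nondegenerate_euclidean_iff hε h1 h2 f c).1 (hf.2 c.1)) heq
    refine ⟨-a, fun v => ?_⟩
    have := ha v
    rw [logCoord_zero, logCoord_zero] at this
    linarith
  have hyp : ∀ f g : T.Vertex → ℝ, T.IsHyperbolicDCS ε η f →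
      T.curvature (T.angleAt ε η 1 f) = T.curvature (T.angleAt ε η 1 g) → f = g := by
    intro f g hf heq
    obtain ⟨a, ha, ha'⟩ := logCoord_sub_eq hT hε h1 h2 (Or.inr rfl)
      (fun c => (nondegenerate_hyperbolic_iff hε h1 h2 f c).1 (hf.2 c.1)) heq
    funext v
    have := ha' v
    rw [ha rfl, sub_eq_zero] at this
    exact (logCoord_injective this).symm
  refine ⟨fun f hf f' => ⟨fun ⟨_, heq⟩ => ?_, ?_⟩, fun f f' hf _ heq => ?_,
    fun fA hA fB heq => ?_, fun fA hA fB heq => ?_⟩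
  · rw [hE, hE] at heq
    exact euc f f' hf heq.symm
  · rintro ⟨a, ha⟩
    obtain rfl : f' = fun v => f v + a := funext ha
    have hlen : T.euclideanLength ε η (fun v => f v + a)
        = fun e => Real.exp a * T.euclideanLength ε η f e :=
      funext (euclideanLength_add_const f a)
    unfold IsEuclideanDCS euclideanCurvature
    rw [hlen, euclideanAngle_smul (Real.exp_pos a)]
    exact ⟨isPolyhedralMetric_smul (Real.exp_pos a) hf, rfl⟩
  · rw [hH, hH] at heq
    exact hyp f f' hf heq
  · rw [hE, hEx] at heq
    obtain ⟨a, ha⟩ := euc fA fB hA heq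
    refine ⟨Real.exp (-a), Real.exp_pos _, fun v => ?_⟩
    rw [ha, ← Real.exp_add]
    congr 1
    ring
  · rw [hH, hHx] at heq
    exact hyp fA fB hA heq
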